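/- For $\alpha>0$ let $\mathcal G_\alpha$ be the diagonal comb: the metric graph obtained from the half-open interval $(0,1]$ (the shaft) by placing a vertex at each point $n^{-\alpha}$, $n=1,2,3,\dots$, and attaching there an edge (a tooth) of length $n^{-\alpha}$. The point $0$ is not a point of $\mathcal G_\alpha$ but its (only) end. Let $L^2(\mathcal G_\alpha)$ be the Hilbert sum of the $L^2$-spaces of the edges, and let $H^1(\mathcal G_\alpha)$ be the space of all continuous functions $f$ on $\mathcal G_\alpha$ that are absolutely continuous on every edge and satisfy $\|f\|_{H^1}^2:=\|f\|_{L^2}^2+\|f'\|_{L^2}^2<\infty$. Let $H^1_0(\mathcal G_\alpha;\mathfrak V)$ be the subspace of the $f\in H^1(\mathcal G_\alpha)$ that vanish at the tips of all teeth and tend to $0$ at the end $0$. Functions may be real- or complex-valued. The Neumann extension $\mathcal H_N$ and the operator $\mathcal H_{\mathfrak V}$ are the self-adjoint operators in $L^2(\mathcal G_\alpha)$ associated with the form $f\mapsto\int_{\mathcal G_\alpha}|f'(x)|^2\,dx$ with domain $H^1(\mathcal G_\alpha)$ and $H^1_0(\mathcal G_\alpha;\mathfrak V)$, respectively. The essential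 spectrum of a self-adjoint operator is its spectrum without the isolated points that are eigenvalues of finite multiplicity, and the spectrum is purely discrete if the essential spectrum is empty. Theorem. Let $\alpha>0$. The operators $\mathcal H_N$ and $\mathcal H_{\mathfrak V}$ are well-defined and self-adjoint, and: (1) If $\alpha>\frac12$, then $H^1(\mathcal G_\alpha)$ is compactly embedded in $L^2(\mathcal G_\alpha)$, and $\mathcal H_N$ has compact resolvent and purely discrete spectrum. (2) If $\alpha\le\frac12$, then there is an $L^2(\mathcal G_\alpha)$-orthonormal sequence of functions in $H^1(\mathcal G_\alpha)$ that is bounded in $H^1(\mathcal G_\alpha)$, and $\mathcal H_N$ has nonempty essential spectrum. (3) For every $\alpha>0$, $H^1_0(\mathcal G_\alpha;\mathfrak V)$ is compactly embedded in $L^2(\mathcal G_\alpha)$, and $\mathcal H_{\mathfrak V}$ has compact resolvent and purely discrete spectrum. -/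

import Mathlib

open MeasureTheory Filter Topology Set

noncomputable section

/-- A metric graph: countably many edges `e ≃ [0, len e]` of finite positive length, together with
the vertex at which each of the two ends `0` (`false`) and `len e` (`true`) of an edge is glued.
Loops and parallel edges are allowed, and every vertex is an end of some edge. -/
structure MetricGraph where
  Edge : Type
  Vertex : Type
  countable_edge : Countable Edge
  len : Edge → ℝ
  len_pos : ∀ e, 0 < len e
  vtx : Edge → Bool → Vertex
  vtx_surj : ∀ v, ∃ e b, vtx e b = v

namespace MetricGraph

variable (G : MetricGraph)

/-- The disjoint union of the metric edges. -/
abbrev Edges : Type := Σ e : G.Edge, Icc (0 : ℝ) (G.len e)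

/-- The two ends of an edge, `false` for `0` and `true` for `len e`. -/
def endpt (e : G.Edge) (b : Bool) : G.Edges :=
  ⟨e, if b then ⟨G.len e, (G.len_pos e).le, le_rfl⟩ else ⟨0, le_rfl, (G.len_pos e).le⟩⟩

/-- Two ends of edges are identified when they are glued at the same vertex. -/
def Glue (p q : G.Edges) : Prop :=
  ∃ e b e' b', p = G.endpt e b ∧ q = G.endpt e' b' ∧ G.vtx e b = G.vtx e' b'

/-- The space of all points of the graph. It carries the quotient topology, which for a locally
finite graph is the topology of the path metric. -/
abbrev Space : Type := Quot G.Glue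

/-- The point with coordinate `x ∈ [0, len e]` on the edge `e` (`x` is clamped to this interval). -/
def pt (e : G.Edge) (x : ℝ) : G.Space :=
  Quot.mk G.Glue ⟨e, projIcc 0 (G.len e) (G.len_pos e).le x⟩

/-- `p` is the point of the graph given by the vertex `v`. -/
def IsVertexPt (v : G.Vertex) (p : G.Space) : Prop :=
  ∃ e b, G.vtx e b = v ∧ p = Quot.mk G.Glue (G.endpt e b)

variable (𝕜 : Type*) [RCLike 𝕜]

/-- `L²(G)`, the Hilbert sum of the spaces `L²(0, len e)` over the edges `e`. -/
abbrev L2 : Type _ :=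
  lp (fun e : G.Edge => Lp 𝕜 2 ((volume : Measure ℝ).restrict (Icc 0 (G.len e)))) 2

variable {G 𝕜}

/-- `f` is a continuous function on the graph which on every edge is absolutely continuous,
with classes `f_e = u e` and `f_e' = v e` in `L²`. Since `u v : L²(G)`, the sum over the edges of
the squared `H¹`-norms is finite. -/
structure IsH1Rep (f : G.Space → 𝕜) (u v : G.L2 𝕜) : Prop where
  cont : Continuous f
  ac : ∀ e, AbsolutelyContinuousOnInterval (fun x : ℝ => f (G.pt e x)) 0 (G.len e)
  eq_ae : ∀ e, ∀ᵐ x ∂((volume : Measure ℝ).restrict (Icc 0 (G.len e))), u e x = f (G.pt e x)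
  deriv_ae : ∀ e, ∀ᵐ x ∂((volume : Measure ℝ).restrict (Icc 0 (G.len e))),
    HasDerivAt (fun x : ℝ => f (G.pt e x)) (v e x) x

theorem IsH1Rep.zero : IsH1Rep (fun _ : G.Space => (0 : 𝕜)) 0 0 where
  cont := continuous_const
  ac e := by
    simpa using (LipschitzOnWith.absolutelyContinuousOnInterval (K := 0)
      ((LipschitzWith.const (0 : 𝕜)).lipschitzOnWith (s := uIcc 0 (G.len e))))
  eq_ae e := by
    filter_upwards [Lp.coeFn_zero 𝕜 2 ((volume : Measure ℝ).restrict (Icc 0 (G.len e)))] with x hx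
    simpa using hx
  deriv_ae e := by
    filter_upwards [Lp.coeFn_zero 𝕜 2 ((volume : Measure ℝ).restrict (Icc 0 (G.len e)))] with x hx
    have : ((0 : G.L2 𝕜) e : ℝ → 𝕜) x = 0 := by simpa using hx
    rw [this]
    exact hasDerivAt_const x (0 : 𝕜)

theorem IsH1Rep.add {f g : G.Space → 𝕜} {u v u' v' : G.L2 𝕜}
    (hf : IsH1Rep f u v) (hg : IsH1Rep g u' v') :
    IsH1Rep (fun p => f p + g p) (u + u') (v + v') where
  cont := hf.cont.add hg.cont
  ac e := (hf.ac e).add (hg.ac e)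
  eq_ae e := by
    filter_upwards [hf.eq_ae e, hg.eq_ae e, Lp.coeFn_add (u e) (u' e)] with x h1 h2 h3
    rw [← h1, ← h2]
    simpa using h3
  deriv_ae e := by
    filter_upwards [hf.deriv_ae e, hg.deriv_ae e, Lp.coeFn_add (v e) (v' e)] with x h1 h2 h3
    have : ((v + v') e : ℝ → 𝕜) x = v e x + v' e x := by simpa using h3
    rw [this]
    exact h1.add h2

theorem IsH1Rep.smul {f : G.Space → 𝕜} {u v : G.L2 𝕜} (c : 𝕜) (hf : IsH1Rep f u v) :
    IsH1Rep (fun p => c • f p) (c • u) (c • v) where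
  cont := hf.cont.const_smul c
  ac e := (hf.ac e).const_smul c
  eq_ae e := by
    filter_upwards [hf.eq_ae e, Lp.coeFn_smul c (u e)] with x h1 h3
    rw [← h1]
    simpa using h3
  deriv_ae e := by
    filter_upwards [hf.deriv_ae e, Lp.coeFn_smul c (v e)] with x h1 h3
    have : ((c • v) e : ℝ → 𝕜) x = c • v e x := by simpa using h3
    rw [this]
    exact h1.const_smul c

variable (G 𝕜)

/-- The Sobolev space `H¹(G; S, F)` of all `f ∈ H¹(G)` that vanish at the vertices in `S` and at
the ends of `G` whose neighbourhood filters (traced on `G`) belong to `F`; the value of `f` at an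
end is its limit there. A function `f` is stored as the pair `(f, f') ∈ L²(G) × L²(G)`, in
which `f'` is determined by `f`, so that `‖f‖² = ‖f‖²_{L²} + ‖f'‖²_{L²}` is the norm of the pair. -/
def H1Dirichlet (S : Set G.Vertex) (F : Set (Filter G.Space)) :
    Submodule 𝕜 (WithLp 2 (G.L2 𝕜 × G.L2 𝕜)) where
  carrier := {w | ∃ f : G.Space → 𝕜, IsH1Rep f w.fst w.snd ∧
    (∀ s ∈ S, ∀ p, G.IsVertexPt s p → f p = 0) ∧ ∀ l ∈ F, Tendsto f l (𝓝 0)}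
  zero_mem' := ⟨_, IsH1Rep.zero, fun _ _ _ _ => rfl, fun _ _ => tendsto_const_nhds⟩
  add_mem' := by
    rintro a b ⟨f, hf, hf1, hf2⟩ ⟨g, hg, hg1, hg2⟩
    refine ⟨_, hf.add hg, fun s hs p hp => ?_, fun l hl => ?_⟩
    · rw [hf1 s hs p hp, hg1 s hs p hp, add_zero]
    · simpa using (hf2 l hl).add (hg2 l hl)
  smul_mem' := by
    rintro c a ⟨f, hf, hf1, hf2⟩
    refine ⟨_, hf.smul c, fun s hs p hp => ?_, fun l hl => ?_⟩
    · rw [hf1 s hs p hp, smul_zero]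
    · simpa using (hf2 l hl).const_smul c

/-- The Sobolev space `H¹(G)`. -/
def H1 : Submodule 𝕜 (WithLp 2 (G.L2 𝕜 × G.L2 𝕜)) := G.H1Dirichlet 𝕜 ∅ ∅

end MetricGraph

section Forms

variable {𝕜 H : Type*} [RCLike 𝕜] [NormedAddCommGroup H] [InnerProductSpace 𝕜 H]

/-- The embedding `f ↦ f` of a form domain `K`, whose elements are stored as pairs `(f, f')`,
into `H`. -/
def formEmbedding (K : Submodule 𝕜 (WithLp 2 (H × H))) : K →L[𝕜] H :=
  (WithLp.fstL 2 𝕜 H H).comp K.subtypeL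

/-- The graph of the operator associated with the form `t(f, g) = ⟪f', g'⟫` on `K`: the pairs
`(f, w)` with `f ∈ K` and `t(g, f) = ⟪g, w⟫` for all `g ∈ K`. -/
def formGraph (K : Submodule 𝕜 (WithLp 2 (H × H))) : Submodule 𝕜 (H × H) where
  carrier := {p | ∃ f ∈ K, f.fst = p.1 ∧ ∀ g ∈ K, inner 𝕜 g.snd f.snd = inner 𝕜 g.fst p.2}
  zero_mem' := ⟨0, K.zero_mem, rfl, fun g _ => by simp⟩
  add_mem' := by
    rintro p q ⟨f, hf, hfp, h⟩ ⟨f', hf', hfq, h'⟩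
    refine ⟨f + f', K.add_mem hf hf', by simp [hfp, hfq], fun g hg => ?_⟩
    simp [inner_add_right, h g hg, h' g hg]
  smul_mem' := by
    rintro c p ⟨f, hf, hfp, h⟩
    refine ⟨c • f, K.smul_mem c hf, by simp [hfp], fun g hg => ?_⟩
    simp [inner_smul_right, h g hg]

/-- The operator associated with the form `t(f, g) = ⟪f', g'⟫` with (dense) form domain `K`. -/
def formOperator (K : Submodule 𝕜 (WithLp 2 (H × H))) : H →ₗ.[𝕜] H :=
  (formGraph K).toLinearPMap

end Forms

namespace LinearPMap

variable {𝕜 H : Type*} [RCLike 𝕜] [NormedAddCommGroup H] [InnerProductSpace 𝕜 H]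

/-- `R` is a bounded, everywhere defined two-sided inverse of `A - z`. -/
def IsResolventAt (A : H →ₗ.[𝕜] H) (z : 𝕜) (R : H →L[𝕜] H) : Prop :=
  (∀ g : H, ∃ h : R g ∈ A.domain, A ⟨R g, h⟩ - z • R g = g) ∧
    ∀ u : A.domain, R (A u - z • (u : H)) = u

/-- The spectrum of an unbounded operator. -/
def unboundedSpectrum (A : H →ₗ.[𝕜] H) : Set 𝕜 := {z | ¬ ∃ R, A.IsResolventAt z R}

/-- The kernel of `A - z`. -/
def eigenspace (A : H →ₗ.[𝕜] H) (z : 𝕜) : Submodule 𝕜 H where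
  carrier := {u | ∃ h : u ∈ A.domain, A ⟨u, h⟩ = z • u}
  zero_mem' := ⟨A.domain.zero_mem, by rw [smul_zero]; exact A.map_zero⟩
  add_mem' := by
    rintro u v ⟨hu, hu'⟩ ⟨hv, hv'⟩
    refine ⟨A.domain.add_mem hu hv, ?_⟩
    rw [smul_add, ← hu', ← hv']
    exact A.map_add ⟨u, hu⟩ ⟨v, hv⟩
  smul_mem' := by
    rintro c u ⟨hu, hu'⟩
    refine ⟨A.domain.smul_mem c hu, ?_⟩
    rw [smul_comm, ← hu']
    exact A.map_smul c ⟨u, hu⟩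

/-- The discrete spectrum: the isolated points of the spectrum that are eigenvalues of finite
multiplicity. -/
def discreteSpectrum (A : H →ₗ.[𝕜] H) : Set 𝕜 :=
  {z | z ∈ A.unboundedSpectrum ∧ ¬ AccPt z (𝓟 A.unboundedSpectrum) ∧
    A.eigenspace z ≠ ⊥ ∧ FiniteDimensional 𝕜 (A.eigenspace z)}

/-- The essential spectrum (of a self-adjoint operator). -/
def essentialSpectrum (A : H →ₗ.[𝕜] H) : Set 𝕜 := A.unboundedSpectrum \ A.discreteSpectrum

/-- The spectrum consists of isolated eigenvalues of finite multiplicity. -/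
def HasPurelyDiscreteSpectrum (A : H →ₗ.[𝕜] H) : Prop :=
  A.unboundedSpectrum = A.discreteSpectrum

/-- The resolvent set is nonempty and all resolvents are compact. -/
def HasCompactResolvent (A : H →ₗ.[𝕜] H) : Prop :=
  (∃ z R, A.IsResolventAt z R) ∧ ∀ z R, A.IsResolventAt z R → IsCompactOperator R

end LinearPMap

namespace MetricGraph

/-- The Neumann extension: the operator of the form `∫ |f'|²` on `H¹(G)`. -/
def neumannLaplacian (G : MetricGraph) (𝕜 : Type*) [RCLike 𝕜] : G.L2 𝕜 →ₗ.[𝕜] G.L2 𝕜 :=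
  formOperator (G.H1 𝕜)

/-- The Laplacian with mixed conditions: the operator of the form `∫ |f'|²` on the functions of
`H¹(G)` that vanish at the vertices in `S` and at the ends in `F`. -/
def mixedLaplacian (G : MetricGraph) (𝕜 : Type*) [RCLike 𝕜] (S : Set G.Vertex)
    (F : Set (Filter G.Space)) : G.L2 𝕜 →ₗ.[𝕜] G.L2 𝕜 :=
  formOperator (G.H1Dirichlet 𝕜 S F)

end MetricGraph

namespace DiagonalComb

/-- Edges of the comb: `shaft n` is the piece `[(n+2)^(-α), (n+1)^(-α)]` of the horizontal shaft
and `tooth n` is the tooth attached at the point `(n+1)^(-α)`. -/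
inductive Edge
  | shaft (n : ℕ)
  | tooth (n : ℕ)

/-- Vertices of the comb: `joint n` is the point `(n+1)^(-α)` of the shaft and `tip n` is the free
end of the tooth attached there. -/
inductive Vertex
  | joint (n : ℕ)
  | tip (n : ℕ)

/-- The number of an edge. -/
def Edge.index : Edge → ℕ
  | shaft n => n
  | tooth n => n

instance : Countable Edge :=
  Function.Surjective.countable (f := fun x : ℕ ⊕ ℕ => Sum.elim Edge.shaft Edge.tooth x) (by
    rintro (n | n)
    exacts [⟨Sum.inl n, rfl⟩, ⟨Sum.inr n, rfl⟩])

/-- The point `(n+1)^(-α)`, for `n = 0, 1, 2, …`. -/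
def node (α : ℝ) (n : ℕ) : ℝ := ((n : ℝ) + 1) ^ (-α)

/-- The length of an edge: a piece of the shaft has the distance of its two nodes, a tooth is as
long as its distance from `0` along the shaft. -/
def len (α : ℝ) : Edge → ℝ
  | .shaft n => node α n - node α (n + 1)
  | .tooth n => node α n

theorem len_pos {α : ℝ} (hα : 0 < α) (e : Edge) : 0 < len α e := by
  rcases e with n | n
  · have h : node α (n + 1) < node α n := by
      unfold node
      apply Real.rpow_lt_rpow_of_neg (by positivity) _ (by linarith)
      push_cast
      linarith
    simpa [len] using h
  · simp only [len, node]
    positivity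

/-- The piece `shaft n` runs from `joint (n+1)` to `joint n`, the tooth from `joint n` to
`tip n`. -/
def vtx : Edge → Bool → Vertex
  | .shaft n, false => .joint (n + 1)
  | .shaft n, true => .joint n
  | .tooth n, false => .joint n
  | .tooth n, true => .tip n

end DiagonalComb

/-- The diagonal comb: the shaft `(0, 1]` with a tooth of length `n^(-α)` attached at `n^(-α)` for
every `n = 1, 2, 3, …`. -/
def diagonalComb (α : ℝ) (hα : 0 < α) : MetricGraph where
  Edge := DiagonalComb.Edge
  Vertex := DiagonalComb.Vertex
  countable_edge := inferInstance
  len := DiagonalComb.len α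
  len_pos := DiagonalComb.len_pos hα
  vtx := DiagonalComb.vtx
  vtx_surj := by
    rintro (n | n)
    exacts [⟨.tooth n, false, rfl⟩, ⟨.tooth n, true, rfl⟩]

namespace DiagonalComb

/-- The tips of the teeth. -/
def tips (α : ℝ) (hα : 0 < α) : Set (diagonalComb α hα).Vertex := range Vertex.tip

/-- The end `0` of the comb, as the filter of its neighbourhoods: a set belongs to it when it
contains all but finitely many of the edges, that is, all points whose distance from `0` in the
comb is small enough. -/
def endZero (α : ℝ) (hα : 0 < α) : Filter (diagonalComb α hα).Space :=
  ⨅ N : ℕ, 𝓟 {p | ∃ e : Edge, N ≤ e.index ∧ ∃ x : ℝ, p = (diagonalComb α hα).pt e x}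

/-- `H¹` of the comb with Dirichlet conditions at `0` and at the tips of the teeth. -/
def H1Dirichlet (𝕜 : Type*) [RCLike 𝕜] (α : ℝ) (hα : 0 < α) :
    Submodule 𝕜 (WithLp 2 ((diagonalComb α hα).L2 𝕜 × (diagonalComb α hα).L2 𝕜)) :=
  (diagonalComb α hα).H1Dirichlet 𝕜 (tips α hα) {endZero α hα}

/-- The Laplacian on the comb with Dirichlet conditions at `0` and at the tips of the teeth. -/
def dirichletLaplacian (𝕜 : Type*) [RCLike 𝕜] (α : ℝ) (hα : 0 < α) :
    (diagonalComb α hα).L2 𝕜 →ₗ.[𝕜] (diagonalComb α hα).L2 𝕜 :=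
  (diagonalComb α hα).mixedLaplacian 𝕜 (tips α hα) {endZero α hα}

end DiagonalComb

end

/-! Write `ι` for the embedding of a form domain into `L²`. A function in `H¹` of the comb is
bounded by a multiple of its norm, since the first tooth and the shaft both have length 1. Hence
uniform limits preserve continuity and the boundary conditions, and the forms are closed. They are
densely defined because they contain the test functions on single edges. Riesz' theorem then gives
`(A + 1)⁻¹ = ι ι*`, a bounded symmetric injective operator `R`, and every assertion about the
unbounded operator `A` is read off from `R`. If `ι` is compact, so is `R`, and the nonzero spectrum
of `R` consists of isolated eigenvalues of finite multiplicity. If an orthonormal sequence is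
bounded in `H¹`, the form of `R` is bounded below along it, so the top `l` of the essential spectrum
of `R` is positive and `l⁻¹ - 1` is in the essential spectrum of `A`.

Whether `ι` is compact is a matter of small tails, since Rellich's theorem handles finitely many
edges. The shaft has finite length and functions are bounded, so its tail is harmless. On a tooth of
length `ℓ`, Poincaré's inequality gives `‖f‖² ≤ 2 ℓ |f(x)|² + 2 ℓ² ‖f'‖²` for any point `x` of the
tooth. With Dirichlet conditions take `x` to be the tip. Otherwise take the joint, and ask whether
`∑ ℓ |f(joint)|²` has uniformly small tails. For `α > 1` it does because `∑ ℓ < ∞`. For `α ≤ 1` the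
teeth have infinite total length, so `f ∈ L²` becomes small at infinitely many joints, whence
`|f(joint)|² ≤ ℓ ‖f'‖²`, and `∑ ℓ²` converges exactly when `α > 1/2`.

For `α ≤ 1/2` compactness fails on tents of slope 1 along the shaft, centred at `s = (m+1)^(-α)` and
constant on each tooth. Their energy is of order `s`, while about `m` teeth of length about `s`
carry values about `s`, which gives a squared norm of order `m s³`, at least of order `s` because
`(m+1) s² ≥ 1`. The key lemmas are `exists_essential_approximate_eigenvalue`,
`isCompactOperator_formEmbedding`, `norm_jointVal_le_of_le_one` and `le_norm_sq_of_tent`. -/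

noncomputable section

/-! ### Compactness and approximate spectrum of bounded symmetric operators, over the real or
complex field. -/

section BoundedOperators

variable {𝕜 H : Type*} [RCLike 𝕜] [NormedAddCommGroup H] [InnerProductSpace 𝕜 H]

/-- A bounded operator on a Hilbert space that is small on the orthogonal complement of a finite
set is compact. -/
theorem isCompactOperator_of_small_on_orthogonal {E F : Type*} [NormedAddCommGroup E]
    [InnerProductSpace 𝕜 E] [NormedAddCommGroup F] [NormedSpace 𝕜 F]
    [CompleteSpace F] (T : E →L[𝕜] F)
    (h : ∀ ε > (0 : ℝ), ∃ s : Set E, s.Finite ∧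
      ∀ x, (∀ y ∈ s, inner 𝕜 y x = 0) → ‖T x‖ ≤ ε * ‖x‖) :
    IsCompactOperator T := by
  have hc := isClosed_setOfPred_isCompactOperator (σ₁₂ := RingHom.id 𝕜) (M₁ := E) (M₂ := F)
  refine hc.closure_subset (Metric.mem_closure_iff.2 fun ε hε => ?_)
  obtain ⟨s, hs, hsT⟩ := h (ε / 2) (half_pos hε)
  have : FiniteDimensional 𝕜 (Submodule.span 𝕜 s) := FiniteDimensional.span_of_finite 𝕜 hs
  set V := Submodule.span 𝕜 s
  refine ⟨T.comp V.starProjection, ?_, ?_⟩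
  · have : LocallyCompactSpace V := by
      have := FiniteDimensional.proper_rclike 𝕜 V
      infer_instance
    exact (isCompactOperator_of_locallyCompactSpace_rng (T.comp V.subtypeL)).comp_clm
      V.orthogonalProjectionOnto
  · refine lt_of_le_of_lt ?_ (half_lt_self hε)
    rw [dist_eq_norm]
    refine ContinuousLinearMap.opNorm_le_bound _ (half_pos hε).le fun x => ?_
    have h1 := V.sub_starProjection_mem_orthogonal x
    have h2 := hsT (x - V.starProjection x) fun y hy => h1 y (Submodule.subset_span hy)
    have h3 : ‖x - V.starProjection x‖ ≤ ‖x‖ := by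
      have := Vᗮ.norm_starProjection_apply_le x
      rwa [Submodule.starProjection_orthogonal_val] at this
    simpa using h2.trans (by gcongr)

/-- The operator `T` is bounded below by a positive constant. -/
def IsBoundedBelow (T : H →L[𝕜] H) : Prop := ∃ c > (0 : ℝ), ∀ x, c * ‖x‖ ≤ ‖T x‖

theorem IsBoundedBelow.mul {S T : H →L[𝕜] H} (hS : IsBoundedBelow S) (hT : IsBoundedBelow T) :
    IsBoundedBelow (S * T) := by
  obtain ⟨c, hc, h⟩ := hS
  obtain ⟨d, hd, h'⟩ := hT
  refine ⟨c * d, mul_pos hc hd, fun x => ?_⟩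
  calc c * d * ‖x‖ = c * (d * ‖x‖) := by ring
    _ ≤ c * ‖T x‖ := by gcongr; exact h' x
    _ ≤ _ := h _

/-- A form of the Cauchy–Schwarz inequality for a symmetric operator that is nonnegative on a
subspace. -/
theorem norm_apply_sq_le_of_nonneg_on {D : H →L[𝕜] H} (hD : (D : H →ₗ[𝕜] H).IsSymmetric)
    (V : Submodule 𝕜 H) (hV : ∀ v ∈ V, 0 ≤ RCLike.re (inner 𝕜 (D v) v)) {x : H} (hx : x ∈ V)
    (hDx : D x ∈ V) : ‖D x‖ ^ 2 ≤ ‖D‖ * RCLike.re (inner 𝕜 (D x) x) := by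
  rcases (norm_nonneg D).eq_or_lt with h0 | h0
  · have : D = 0 := norm_eq_zero.1 h0.symm
    simp [this]
  -- The form is nonnegative at `x - t D x`, a vector of `V`; the value `t = 1/‖D‖` makes the
  -- quadratic term at most `t ‖D x‖²`.
  set t : ℝ := ‖D‖⁻¹
  have h1 := hV (x - (t : 𝕜) • D x) (V.sub_mem hx (V.smul_mem _ hDx))
  have hs : inner 𝕜 (D (D x)) x = inner 𝕜 (D x) (D x) := hD (D x) x
  have h2 : RCLike.re (inner 𝕜 (D (x - (t : 𝕜) • D x)) (x - (t : 𝕜) • D x)) =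
      RCLike.re (inner 𝕜 (D x) x) - 2 * t * ‖D x‖ ^ 2
        + t ^ 2 * RCLike.re (inner 𝕜 (D (D x)) (D x)) := by
    simp only [map_sub, map_smul, inner_sub_left, inner_sub_right, inner_smul_left,
      inner_smul_right, hs, RCLike.conj_ofReal, inner_self_eq_norm_sq_to_K]
    simp only [← RCLike.ofReal_pow, map_sub, RCLike.re_ofReal_mul, RCLike.ofReal_re]
    ring
  have h3 : RCLike.re (inner 𝕜 (D (D x)) (D x)) ≤ ‖D‖ * ‖D x‖ ^ 2 := by
    calc _ ≤ ‖D (D x)‖ * ‖D x‖ := re_inner_le_norm _ _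
      _ ≤ ‖D‖ * ‖D x‖ * ‖D x‖ := by gcongr; exact D.le_opNorm _
      _ = _ := by ring
  have ht : t * ‖D‖ = 1 := inv_mul_cancel₀ h0.ne'
  have htp : 0 < t := inv_pos.2 h0
  rw [h2] at h1
  have h4 : t ^ 2 * RCLike.re (inner 𝕜 (D (D x)) (D x)) ≤ t * ‖D x‖ ^ 2 := by
    calc _ ≤ t ^ 2 * (‖D‖ * ‖D x‖ ^ 2) := by gcongr
      _ = t * (t * ‖D‖) * ‖D x‖ ^ 2 := by ring
      _ = _ := by rw [ht, mul_one]
  have h5 : t * ‖D x‖ ^ 2 ≤ RCLike.re (inner 𝕜 (D x) x) := by linarith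
  calc ‖D x‖ ^ 2 = ‖D‖ * (t * ‖D x‖ ^ 2) := by rw [← mul_assoc, mul_comm ‖D‖, ht, one_mul]
    _ ≤ _ := by gcongr

/-- If the quadratic form of a symmetric operator takes a negative value, then a negative number
belongs to its approximate point spectrum. -/
theorem exists_pos_not_isBoundedBelow_add {Q : H →L[𝕜] H} (hQ : (Q : H →ₗ[𝕜] H).IsSymmetric)
    {x₀ : H} (h₀ : RCLike.re (inner 𝕜 (Q x₀) x₀) < 0) :
    ∃ ε > (0 : ℝ), ¬ IsBoundedBelow (Q + (ε : 𝕜) • (1 : H →L[𝕜] H)) := by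
  -- The number wanted is `ε = inf S`, minus the bottom of the form of `Q`. Were `Q + ε` bounded
  -- below, its form would be at least some `η > 0` on unit vectors, and `ε - η` would still lie in
  -- `S`.
  set S : Set ℝ := {c | ∀ x, 0 ≤ RCLike.re (inner 𝕜 (Q x) x) + c * ‖x‖ ^ 2}
  have hx₀ : 0 < ‖x₀‖ := by
    rw [norm_pos_iff]
    rintro rfl
    simp at h₀
  have hpos : ∀ c ∈ S, -RCLike.re (inner 𝕜 (Q x₀) x₀) / ‖x₀‖ ^ 2 ≤ c := by
    intro c hc
    rw [div_le_iff₀ (by positivity)]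
    linarith [hc x₀]
  have hne : ‖Q‖ ∈ S := by
    intro x
    have h1 : |RCLike.re (inner 𝕜 (Q x) x)| ≤ ‖Q x‖ * ‖x‖ :=
      (RCLike.abs_re_le_norm _).trans (norm_inner_le_norm _ _)
    have h2 : ‖Q x‖ * ‖x‖ ≤ ‖Q‖ * ‖x‖ ^ 2 := by
      calc _ ≤ ‖Q‖ * ‖x‖ * ‖x‖ := by gcongr; exact Q.le_opNorm _
        _ = _ := by ring
    linarith [neg_abs_le (RCLike.re (inner 𝕜 (Q x) x))]
  have hbdd : BddBelow S := ⟨_, hpos⟩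
  set ε := sInf S
  have hεS : ∀ x, 0 ≤ RCLike.re (inner 𝕜 (Q x) x) + ε * ‖x‖ ^ 2 := by
    have hcl : IsClosed S := by
      simp only [S, Set.ofPred_forall]
      exact isClosed_iInter fun x => isClosed_le continuous_const (by fun_prop)
    exact hcl.csInf_mem ⟨_, hne⟩ hbdd
  have hε : 0 < ε := lt_of_lt_of_le (by apply div_pos <;> [linarith; positivity]) (hpos ε hεS)
  refine ⟨ε, hε, ?_⟩
  rintro ⟨c, hc, hb⟩
  set D : H →L[𝕜] H := Q + (ε : 𝕜) • (1 : H →L[𝕜] H)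
  have hDsymm : (D : H →ₗ[𝕜] H).IsSymmetric := by
    intro x y
    have := hQ x y
    simp only [ContinuousLinearMap.coe_coe] at this
    simp [D, inner_add_left, inner_add_right, inner_smul_left, inner_smul_right, this]
  have hDform : ∀ x, RCLike.re (inner 𝕜 (D x) x) =
      RCLike.re (inner 𝕜 (Q x) x) + ε * ‖x‖ ^ 2 := by
    intro x
    simp only [D, add_apply, smul_apply,
      one_apply_eq_self, inner_add_left, inner_smul_left, RCLike.conj_ofReal,
      inner_self_eq_norm_sq_to_K, map_add, RCLike.re_ofReal_mul, ← RCLike.ofReal_pow,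
      RCLike.ofReal_re]
  have hM : 0 < ‖D‖ + 1 := by positivity
  -- From `c² ‖x‖² ≤ ‖D x‖² ≤ ‖D‖ ⟪D x, x⟫`; the added 1 keeps the denominator positive.
  set η := c ^ 2 / (‖D‖ + 1)
  have hη : 0 < η := by positivity
  have hlow : ∀ x, η * ‖x‖ ^ 2 ≤ RCLike.re (inner 𝕜 (D x) x) := by
    intro x
    have h1 := norm_apply_sq_le_of_nonneg_on hDsymm ⊤ (fun v _ => by rw [hDform]; exact hεS v)
      (Submodule.mem_top (x := x)) Submodule.mem_top
    have h2 : 0 ≤ RCLike.re (inner 𝕜 (D x) x) := by rw [hDform]; exact hεS x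
    have h3 : c ^ 2 * ‖x‖ ^ 2 ≤ ‖D x‖ ^ 2 := by
      rw [← mul_pow]
      exact pow_le_pow_left₀ (by positivity) (hb x) 2
    rw [div_mul_eq_mul_div, div_le_iff₀ hM]
    nlinarith
  have hmem : ε - η ∈ S := by
    intro x
    have := hlow x
    rw [hDform] at this
    linarith
  have := csInf_le hbdd hmem
  linarith [this]

theorem isSymmetric_sub_smul {R : H →L[𝕜] H} (hR : (R : H →ₗ[𝕜] H).IsSymmetric) (c : ℝ) :
    ((R - (c : 𝕜) • (1 : H →L[𝕜] H) : H →L[𝕜] H) : H →ₗ[𝕜] H).IsSymmetric := by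
  intro x y
  have := hR x y
  simp only [ContinuousLinearMap.coe_coe] at this
  simp [inner_sub_left, inner_sub_right, inner_smul_left, inner_smul_right, this]

/-- A gap of the spectrum of a symmetric operator around `0` gives a lower bound on its range. -/
theorem mul_norm_apply_le_norm_apply_apply {T : H →L[𝕜] H} (hT : (T : H →ₗ[𝕜] H).IsSymmetric)
    {δ : ℝ} (hδ : 0 < δ)
    (hgap : ∀ μ : ℝ, μ ≠ 0 → |μ| < δ → IsBoundedBelow (T - (μ : 𝕜) • (1 : H →L[𝕜] H))) (x : H) :
    δ * ‖T x‖ ≤ ‖T (T x)‖ := by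
  by_contra! hlt
  have hT' : ∀ x y : H, inner 𝕜 (T x) y = inner 𝕜 x (T y) := hT
  -- The form of `Q = T⁴ - δ² T²` at `x` is `‖T² x‖² - δ² ‖T x‖²`, which is negative if the claim
  -- fails. It remains to see that `Q + ε` is bounded below for every `ε > 0`.
  set Q : H →L[𝕜] H := T * T * (T * T) - ((δ ^ 2 : ℝ) : 𝕜) • (T * T)
  have hQ : (Q : H →ₗ[𝕜] H).IsSymmetric := by
    intro x y
    simp [Q, inner_sub_left, inner_sub_right, inner_smul_left, inner_smul_right, hT']
  have hform : ∀ y, RCLike.re (inner 𝕜 (Q y) y) = ‖T (T y)‖ ^ 2 - δ ^ 2 * ‖T y‖ ^ 2 := by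
    intro y
    simp only [Q, sub_apply, smul_apply,
      mul_apply_eq_comp, inner_sub_left, inner_smul_left, RCLike.conj_ofReal, hT',
      map_sub, RCLike.re_ofReal_mul]
    rw [← hT' y, ← hT' y, ← hT' (T y), inner_self_eq_norm_sq, inner_self_eq_norm_sq]
  have hneg : RCLike.re (inner 𝕜 (Q x) x) < 0 := by
    rw [hform, ← mul_pow, sub_neg]
    exact pow_lt_pow_left₀ hlt (norm_nonneg _) two_ne_zero
  obtain ⟨ε, hε, hnot⟩ := exists_pos_not_isBoundedBelow_add hQ hneg
  refine hnot ?_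
  -- For `ε ≤ δ⁴/4` the polynomial `t⁴ - δ² t² + ε` has four real roots `±√u` with `u = δ²/2 ± r` in
  -- `(0, δ²)`, so `Q + ε` is a product of operators covered by `hgap`. For larger `ε` it is `(t² -
  -- δ²/2)²` plus a positive constant. Real factors suffice, so the argument also works for real
  -- scalars.
  rcases le_or_gt ε (δ ^ 4 / 4) with hle | hgt
  · set r := √(δ ^ 4 / 4 - ε)
    have hr : r ^ 2 = δ ^ 4 / 4 - ε := Real.sq_sqrt (by linarith)
    have hr0 : 0 ≤ r := Real.sqrt_nonneg _
    have hrlt : r < δ ^ 2 / 2 := by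
      refine lt_of_pow_lt_pow_left₀ 2 (by positivity) ?_
      rw [hr]
      nlinarith
    have hfac : ∀ u : ℝ, 0 < u → u < δ ^ 2 →
        IsBoundedBelow (T * T - (u : 𝕜) • (1 : H →L[𝕜] H)) := by
      intro u hu huδ
      have hs : √u ≠ 0 := (Real.sqrt_pos.2 hu).ne'
      have hs' : |√u| < δ := by
        rw [abs_of_nonneg (Real.sqrt_nonneg _), Real.sqrt_lt' hδ]
        exact huδ
      have h1 := (hgap (√u) hs hs').mul (hgap (-√u) (neg_ne_zero.2 hs) (by rwa [abs_neg]))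
      convert h1 using 1
      have : (u : 𝕜) = (√u : 𝕜) * (√u : 𝕜) := by
        rw [← RCLike.ofReal_mul, Real.mul_self_sqrt hu.le]
      ext y
      simp only [this, sub_apply, smul_apply,
        mul_apply_eq_comp, one_apply_eq_self, map_sub, map_smul,
        RCLike.ofReal_neg]
      module
    have h1 := (hfac (δ ^ 2 / 2 + r) (by positivity) (by linarith)).mul
      (hfac (δ ^ 2 / 2 - r) (by linarith) (by nlinarith))
    convert h1 using 1
    have he : ε = (δ ^ 2 / 2 + r) * (δ ^ 2 / 2 - r) := by nlinarith
    ext y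
    rw [he]
    simp only [Q, sub_apply, add_apply,
      smul_apply,
      mul_apply_eq_comp, one_apply_eq_self, map_sub, map_smul]
    push_cast
    module
  · refine ⟨ε - δ ^ 4 / 4, by linarith, fun y => ?_⟩
    set L : H →L[𝕜] H := Q + (ε : 𝕜) • (1 : H →L[𝕜] H)
    have h1 : (ε - δ ^ 4 / 4) * ‖y‖ ^ 2 ≤ RCLike.re (inner 𝕜 (L y) y) := by
      have h2 : RCLike.re (inner 𝕜 (L y) y) = RCLike.re (inner 𝕜 (Q y) y) + ε * ‖y‖ ^ 2 := by
        simp only [L, add_apply, smul_apply,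
          one_apply_eq_self, inner_add_left, inner_smul_left, RCLike.conj_ofReal,
          inner_self_eq_norm_sq_to_K, map_add, RCLike.re_ofReal_mul, ← RCLike.ofReal_pow,
          RCLike.ofReal_re]
      have h3 : ‖T y‖ ^ 2 ≤ ‖T (T y)‖ * ‖y‖ := by
        rw [← inner_self_eq_norm_sq (𝕜 := 𝕜), ← hT']
        exact re_inner_le_norm _ _
      rw [h2, hform]
      nlinarith [sq_nonneg (‖T (T y)‖ - δ ^ 2 / 2 * ‖y‖), sq_nonneg δ]
    have h4 : (ε - δ ^ 4 / 4) * ‖y‖ ^ 2 ≤ ‖L y‖ * ‖y‖ := h1.trans (re_inner_le_norm _ _)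
    rcases (norm_nonneg y).eq_or_lt with h0 | h0
    · rw [← h0]; simp
    · nlinarith

/-- The hypothesis is this inequality on the range of `T`. For self-adjoint `T` the closure of the
range is the orthogonal complement of the kernel, and the inequality is a closed condition. -/
theorem mul_norm_le_norm_apply_of_mem_orthogonal_ker [CompleteSpace H] {T : H →L[𝕜] H}
    (hT : (T : H →ₗ[𝕜] H).IsSymmetric) {δ : ℝ} (h : ∀ x, δ * ‖T x‖ ≤ ‖T (T x)‖) {x : H}
    (hx : x ∈ (T : H →ₗ[𝕜] H).kerᗮ) : δ * ‖x‖ ≤ ‖T x‖ := by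
  rw [ContinuousLinearMap.orthogonal_ker, hT.isSelfAdjoint.adjoint_eq] at hx
  have hcl : IsClosed {x : H | δ * ‖x‖ ≤ ‖T x‖} :=
    isClosed_le (by fun_prop) (by fun_prop)
  refine closure_minimal ?_ hcl hx
  rintro _ ⟨y, rfl⟩
  exact h y

/-- By Bessel's inequality the coefficients against each vector of a finite basis of `F` tend to 0.
-/
theorem Orthonormal.tendsto_starProjection {φ : ℕ → H} (hφ : Orthonormal 𝕜 φ)
    (F : Submodule 𝕜 H) [FiniteDimensional 𝕜 F] :
    Tendsto (fun n => ‖F.starProjection (φ n)‖) atTop (𝓝 0) := by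
  set b := stdOrthonormalBasis 𝕜 F
  have h1 : ∀ x, ‖F.starProjection x‖ ^ 2 = ∑ i, ‖inner 𝕜 x (b i : H)‖ ^ 2 := by
    intro x
    have := b.sum_sq_norm_inner_right (F.orthogonalProjectionOnto x)
    rw [Submodule.starProjection_apply, ← Submodule.coe_norm, ← this]
    refine Finset.sum_congr rfl fun i _ => ?_
    rw [← inner_conj_symm, RCLike.norm_conj,
      Submodule.inner_orthogonalProjectionOnto_eq_of_mem_right]
  have h2 : Tendsto (fun n => ‖F.starProjection (φ n)‖ ^ 2) atTop (𝓝 0) := by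
    simp only [h1]
    have := tendsto_finsetSum Finset.univ fun i (_ : i ∈ Finset.univ) =>
      (hφ.inner_products_summable (b i : H)).tendsto_atTop_zero
    simpa using this
  have h3 := h2.sqrt
  simpa [Real.sqrt_sq] using h3

/-- If the form of `R` is bounded below along an orthonormal sequence, then `R` has a positive
number `λ` in its essential spectrum: there are approximate eigenvectors orthogonal to any given
finite-dimensional subspace. -/
theorem exists_essential_approximate_eigenvalue {R : H →L[𝕜] H}
    (hR : (R : H →ₗ[𝕜] H).IsSymmetric) {φ : ℕ → H} (hφ : Orthonormal 𝕜 φ) {c₀ : ℝ} (hc₀ : 0 < c₀)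
    (hRφ : ∀ n, c₀ ≤ RCLike.re (inner 𝕜 (R (φ n)) (φ n))) :
    ∃ l : ℝ, 0 < l ∧ ∀ E : Submodule 𝕜 H, FiniteDimensional 𝕜 E → ∀ d > (0 : ℝ),
      ∃ x ∈ Eᗮ, ‖R x - (l : 𝕜) • x‖ < d * ‖x‖ := by
  have hRs : ∀ x y : H, inner 𝕜 (R x) y = inner 𝕜 x (R y) := hR
  -- By the min-max principle `inf S` is the top of the essential spectrum of `R`; this is the `l`
  -- to be used.
  set S : Set ℝ := {c | ∃ F : Submodule 𝕜 H, FiniteDimensional 𝕜 F ∧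
    ∀ x ∈ Fᗮ, RCLike.re (inner 𝕜 (R x) x) ≤ c * ‖x‖ ^ 2}
  have hbound : ∀ x y, RCLike.re (inner 𝕜 (R x) y) ≤ ‖R‖ * ‖x‖ * ‖y‖ := fun x y =>
    (re_inner_le_norm _ _).trans (by gcongr; exact R.le_opNorm _)
  have hne : S.Nonempty := ⟨‖R‖, ⊥, inferInstance, fun x _ => by
    have := hbound x x
    linarith [mul_assoc ‖R‖ ‖x‖ ‖x‖, sq ‖x‖]⟩
  have hlow : ∀ c ∈ S, c₀ ≤ c := by
    rintro c ⟨F, hF, h⟩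
    have hP := hφ.tendsto_starProjection F
    -- The vector `φ n` differs from its component in `Fᗮ` by `p`, which tends to 0; all errors are
    -- bounded in terms of `‖p‖`.
    have hle : ∀ n, c₀ ≤ |c| * (‖F.starProjection (φ n)‖ ^ 2) + c
        + 2 * (‖R‖ * ‖F.starProjection (φ n)‖ * 1) := by
      intro n
      set p := F.starProjection (φ n)
      have hy : φ n - p ∈ Fᗮ := F.sub_starProjection_mem_orthogonal (φ n)
      have h1 := h _ hy
      have hpF : p ∈ F := by simp [p]
      have hpy : inner 𝕜 p (φ n - p) = 0 := hy p hpF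
      have hnorm : ‖φ n - p‖ ^ 2 = 1 - ‖p‖ ^ 2 := by
        have h2 : ‖p + (φ n - p)‖ * ‖p + (φ n - p)‖ = ‖p‖ * ‖p‖ + ‖φ n - p‖ * ‖φ n - p‖ :=
          norm_add_sq_eq_norm_sq_add_norm_sq_of_inner_eq_zero _ _ hpy
        rw [add_sub_cancel, hφ.1 n] at h2
        linarith [sq ‖p‖, sq ‖φ n - p‖]
      have h3 : RCLike.re (inner 𝕜 (R (φ n)) (φ n)) = RCLike.re (inner 𝕜 (R (φ n - p)) (φ n - p))
          + RCLike.re (inner 𝕜 (R p) (φ n)) + RCLike.re (inner 𝕜 (R p) (φ n - p)) := by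
        have h4 : RCLike.re (inner 𝕜 (R p) (φ n - p)) =
            RCLike.re (inner 𝕜 (R (φ n - p)) p) := by
          rw [hRs, ← inner_conj_symm, RCLike.conj_re]
        rw [h4]
        simp only [map_sub, inner_sub_left, inner_sub_right]
        ring
      have h5 := hbound p (φ n)
      have h6 := hbound p (φ n - p)
      have h7 : ‖φ n - p‖ ≤ 1 := by nlinarith [norm_nonneg (φ n - p), sq_nonneg ‖p‖]
      have h8 : ‖R‖ * ‖p‖ * ‖φ n - p‖ ≤ ‖R‖ * ‖p‖ * 1 := by gcongr
      rw [hφ.1 n] at h5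
      have h9 := hRφ n
      rw [hnorm] at h1
      have h10 : -(c * ‖p‖ ^ 2) ≤ |c| * ‖p‖ ^ 2 := by
        rw [← neg_mul]
        gcongr
        exact neg_le_abs c
      linarith
    have hlim : Tendsto (fun n => |c| * (‖F.starProjection (φ n)‖ ^ 2) + c
        + 2 * (‖R‖ * ‖F.starProjection (φ n)‖ * 1)) atTop
        (𝓝 (|c| * (0 ^ 2) + c + 2 * (‖R‖ * 0 * 1))) :=
      (((hP.pow 2).const_mul _).add_const _).add (((hP.const_mul _).mul_const _).const_mul _)
    have := ge_of_tendsto' hlim hle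
    simpa using this
  have hbdd : BddBelow S := ⟨c₀, hlow⟩
  set l := sInf S
  have hl : 0 < l := hc₀.trans_le (le_csInf hne hlow)
  refine ⟨l, hl, fun E hE d hd => ?_⟩
  -- `η` is small compared with `d`
  set M := ‖R‖ + l + 1
  have hM : 0 < M := by positivity
  obtain ⟨η, hη, hη1, hηd⟩ : ∃ η : ℝ, 0 < η ∧ η ≤ 1 ∧ √(M * (2 * η)) + η < d := by
    have hlim : Tendsto (fun η : ℝ => √(M * (2 * η)) + η) (𝓝[>] 0) (𝓝 0) := by
      have : Continuous (fun η : ℝ => √(M * (2 * η)) + η) := by fun_prop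
      have h := this.tendsto 0
      simp only [mul_zero, Real.sqrt_zero, add_zero] at h
      exact h.mono_left nhdsWithin_le_nhds
    have h1 := hlim.eventually (gt_mem_nhds hd)
    have h2 : ∀ᶠ η : ℝ in 𝓝[>] 0, η ≤ 1 :=
      nhdsWithin_le_nhds (eventually_le_nhds one_pos)
    obtain ⟨η, h1, h2, h3⟩ := (h1.and (h2.and self_mem_nhdsWithin)).exists
    exact ⟨η, h3, h2, h1⟩
  obtain ⟨c, ⟨F, hF, hFc⟩, hcl⟩ := exists_lt_of_csInf_lt hne (show sInf S < l + η by
    change l < l + η; linarith)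
  -- On `Fᗮ` the form is at most `l + η`, and on `Gᗮ` some `x` still exceeds `l - η`. The summand
  -- `F.map R` puts `R x` into `Fᗮ`, so that the Cauchy–Schwarz inequality applies to `l + η - R` on
  -- `Fᗮ`; the summand `E` gives `x ∈ Eᗮ`.
  set G := F ⊔ F.map (R : H →ₗ[𝕜] H) ⊔ E
  have hG : FiniteDimensional 𝕜 G := inferInstance
  have hnot : l - η ∉ S := fun h => by
    have := csInf_le hbdd h
    linarith [this]
  obtain ⟨x, hxG, hx⟩ : ∃ x ∈ Gᗮ, (l - η) * ‖x‖ ^ 2 < RCLike.re (inner 𝕜 (R x) x) := by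
    by_contra! h
    exact hnot ⟨G, hG, h⟩
  have hxF : x ∈ Fᗮ := Submodule.orthogonal_le (le_sup_left.trans le_sup_left) hxG
  have hxRF : x ∈ (F.map (R : H →ₗ[𝕜] H))ᗮ :=
    Submodule.orthogonal_le (le_sup_right.trans le_sup_left) hxG
  have hxE : x ∈ Eᗮ := Submodule.orthogonal_le le_sup_right hxG
  have hRx : R x ∈ Fᗮ := by
    intro y hy
    rw [← hRs]
    exact hxRF _ (Submodule.mem_map_of_mem hy)
  have hxpos : 0 < ‖x‖ := by
    rw [norm_pos_iff]
    rintro rfl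
    simp at hx
  refine ⟨x, hxE, ?_⟩
  set D : H →L[𝕜] H := R - ((l + η : ℝ) : 𝕜) • (1 : H →L[𝕜] H)
  have hDs : ((-D : H →L[𝕜] H) : H →ₗ[𝕜] H).IsSymmetric := by
    have h1 := isSymmetric_sub_smul hR (l + η)
    intro y z
    have h2 := h1 y z
    simp only [ContinuousLinearMap.coe_coe] at h2 ⊢
    simp only [neg_apply, inner_neg_left, inner_neg_right]
    rw [h2]
  have hform : ∀ y, RCLike.re (inner 𝕜 ((-D) y) y) =
      (l + η) * ‖y‖ ^ 2 - RCLike.re (inner 𝕜 (R y) y) := by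
    intro y
    simp only [D, sub_apply,
      smul_apply, one_apply_eq_self, neg_sub, inner_sub_left,
      inner_smul_left, RCLike.conj_ofReal, inner_self_eq_norm_sq_to_K, map_sub,
      RCLike.re_ofReal_mul, ← RCLike.ofReal_pow, RCLike.ofReal_re]
  have h1 := norm_apply_sq_le_of_nonneg_on hDs Fᗮ (fun v hv => by
    rw [hform]
    have := hFc v hv
    nlinarith [sq_nonneg ‖v‖]) hxF (by
    simp only [D, neg_apply, sub_apply,
      smul_apply, one_apply_eq_self]
    exact Submodule.neg_mem _ (Submodule.sub_mem _ hRx (Submodule.smul_mem _ _ hxF)))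
  have hDM : ‖-D‖ ≤ M := by
    rw [norm_neg]
    refine (norm_sub_le _ _).trans ?_
    have : ‖((l + η : ℝ) : 𝕜) • (1 : H →L[𝕜] H)‖ ≤ (l + η) * 1 := by
      refine (ContinuousLinearMap.opNorm_smul_le _ _).trans ?_
      rw [RCLike.norm_ofReal, abs_of_pos (by linarith)]
      gcongr
      exact ContinuousLinearMap.norm_id_le
    linarith
  have h2 : ‖(-D) x‖ ^ 2 ≤ M * (2 * η) * ‖x‖ ^ 2 := by
    refine h1.trans ?_
    rw [mul_assoc]
    refine mul_le_mul hDM ?_ ?_ hM.le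
    · rw [hform]; linarith
    · rw [hform]
      have := hFc x hxF
      nlinarith [sq_nonneg ‖x‖]
  have h3 : ‖(-D) x‖ ≤ √(M * (2 * η)) * ‖x‖ := by
    refine le_of_sq_le_sq ?_ (by positivity)
    rw [mul_pow, Real.sq_sqrt (by positivity)]
    exact h2
  have h4 : R x - (l : 𝕜) • x = -((-D) x) + (η : 𝕜) • x := by
    simp only [D, neg_apply, sub_apply,
      smul_apply, one_apply_eq_self]
    push_cast
    module
  calc ‖R x - (l : 𝕜) • x‖ ≤ ‖(-D) x‖ + η * ‖x‖ := by
        rw [h4]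
        refine (norm_add_le _ _).trans ?_
        rw [norm_neg, norm_smul, RCLike.norm_ofReal, abs_of_pos hη]
    _ ≤ (√(M * (2 * η)) + η) * ‖x‖ := by linarith
    _ < d * ‖x‖ := by gcongr

end BoundedOperators

/-! ### From the bounded operator `R = (A + 1)⁻¹` to the spectrum of `A`. -/

section ShiftedResolvent

variable {𝕜 H : Type*} [RCLike 𝕜] [NormedAddCommGroup H] [InnerProductSpace 𝕜 H]

/-- The bounded operator `R` is symmetric and injective, and `R = (A + 1)⁻¹`. -/
structure IsSymmetricInverseAddOne (A : H →ₗ.[𝕜] H) (R : H →L[𝕜] H) : Prop where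
  symm : (R : H →ₗ[𝕜] H).IsSymmetric
  inj : ∀ x, R x = 0 → x = 0
  mem_graph_iff : ∀ u w, (u, w) ∈ A.graph ↔ R (w + u) = u

namespace IsSymmetricInverseAddOne

variable {A : H →ₗ.[𝕜] H} {R : H →L[𝕜] H} (h : IsSymmetricInverseAddOne A R)

include h

theorem inner_comm (x y : H) : inner 𝕜 (R x) y = inner 𝕜 x (R y) := h.symm x y

theorem mem_domain_iff (u : H) : u ∈ A.domain ↔ ∃ x, R x = u := by
  rw [LinearPMap.mem_domain_iff]
  constructor
  · rintro ⟨w, hw⟩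
    exact ⟨_, (h.mem_graph_iff u w).1 hw⟩
  · rintro ⟨x, rfl⟩
    exact ⟨x - R x, (h.mem_graph_iff _ _).2 (by simp)⟩

/-- The domain is the range of `R`, whose orthogonal complement is the kernel of `R* = R`, which is
0. -/
theorem dense_domain [CompleteSpace H] : Dense (A.domain : Set H) := by
  have h1 : ((R : H →ₗ[𝕜] H).range).topologicalClosure = ⊤ := by
    rw [Submodule.topologicalClosure_eq_top_iff, ContinuousLinearMap.orthogonal_range,
      h.symm.isSelfAdjoint.adjoint_eq, LinearMap.ker_eq_bot']
    exact h.inj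
  have h2 : A.domain = (R : H →ₗ[𝕜] H).range := by
    ext u
    rw [h.mem_domain_iff]
    rfl
  rw [h2]
  exact Submodule.dense_iff_topologicalClosure_eq_top.2 h1

/-- The graph of `A` consists of the pairs `(R g, g - R g)`. Tested against these, `(x, y)` belongs
to the adjoint exactly when `x = R (y + x)`, the condition for the graph of `A` itself. -/
theorem isSelfAdjoint [CompleteSpace H] : IsSelfAdjoint A := by
  rw [LinearPMap.isSelfAdjoint_def]
  apply LinearPMap.eq_of_eq_graph
  rw [LinearPMap.adjoint_graph_eq_graph_adjoint h.dense_domain]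
  ext ⟨x, y⟩
  rw [Submodule.mem_adjoint_iff, h.mem_graph_iff]
  constructor
  · intro hxy
    have h1 : ∀ g, inner 𝕜 g (x - R (y + x)) = 0 := by
      intro g
      have := hxy (R g) (g - R g) ((h.mem_graph_iff _ _).2 (by simp))
      simp only [inner_sub_left, h.inner_comm] at this
      rw [map_add, inner_sub_right, inner_add_right, ← this]
      ring
    exact (sub_eq_zero.1 (inner_self_eq_zero.1 (h1 _))).symm
  · intro hxy a b hab
    have h1 := (h.mem_graph_iff a b).1 hab
    have h2 : inner 𝕜 (R (b + a)) (y + x) = inner 𝕜 (b + a) (R (y + x)) := h.inner_comm _ _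
    rw [hxy, h1, inner_add_left, inner_add_right] at h2
    rw [sub_eq_zero]
    exact (add_right_cancel h2).symm

/-- Since `A - z = R⁻¹ - (z + 1)`, inverting `A - z` amounts to two identities between bounded
operators, with no domains left. -/
theorem isResolventAt_iff (z : 𝕜) (S : H →L[𝕜] H) :
    A.IsResolventAt z S ↔
      (∀ g, R (g + (z + 1) • S g) = S g) ∧ ∀ g, S (g - (z + 1) • R g) = R g := by
  have key : ∀ g, (∃ hg : S g ∈ A.domain, A ⟨S g, hg⟩ - z • S g = g) ↔
      R (g + (z + 1) • S g) = S g := by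
    intro g
    have h1 : g + (z + 1) • S g = (g + z • S g) + S g := by module
    rw [h1, ← h.mem_graph_iff, LinearPMap.mem_graph_iff]
    constructor
    · rintro ⟨hg, hA⟩
      exact ⟨⟨S g, hg⟩, rfl, sub_eq_iff_eq_add.1 hA⟩
    · rintro ⟨⟨u, hu⟩, hu', hA⟩
      dsimp only at hu' hA
      subst hu'
      exact ⟨hu, by rw [hA, add_sub_cancel_right]⟩
  refine and_congr (forall_congr' key) ⟨fun hS g => ?_, fun hS u => ?_⟩
  · have hg : (R g, g - R g) ∈ A.graph := (h.mem_graph_iff _ _).2 (by simp)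
    obtain ⟨u, hu, hA⟩ := A.mem_graph_iff.1 hg
    have := hS u
    rw [hA, hu] at this
    dsimp only at this
    convert this using 2
    module
  · have hg := (h.mem_graph_iff _ _).1 (A.mem_graph u)
    have := hS (A u + u)
    rw [hg] at this
    convert this using 2
    module

theorem isResolventAt_neg_one : A.IsResolventAt (-1) R := by
  rw [h.isResolventAt_iff]
  simp

/-- The resolvent identity `S = R (1 + (z + 1) S)` carries compactness from `R` to every resolvent.
-/
theorem hasCompactResolvent (hR : IsCompactOperator R) : A.HasCompactResolvent := by
  refine ⟨⟨-1, R, h.isResolventAt_neg_one⟩, fun z S hS => ?_⟩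
  have h1 := ((h.isResolventAt_iff z S).1 hS).1
  have h2 : (S : H → H) = R ∘ ((1 : H →L[𝕜] H) + (z + 1) • S) := by
    ext g
    simpa using (h1 g).symm
  rw [h2]
  exact hR.comp_clm _

/-- A resolvent `S` at `z` gives the inverse `1 + (z + 1) S`; conversely `R (1 - (z + 1) R)⁻¹` is a
resolvent. -/
theorem mem_unboundedSpectrum_iff (z : 𝕜) :
    z ∈ A.unboundedSpectrum ↔ ¬ IsUnit (1 - (z + 1) • R) := by
  rw [LinearPMap.unboundedSpectrum, mem_ofPred_eq, not_iff_not]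
  simp only [h.isResolventAt_iff]
  constructor
  · rintro ⟨S, h1, h2⟩
    refine ⟨⟨1 - (z + 1) • R, 1 + (z + 1) • S, ?_, ?_⟩, rfl⟩
    · ext g
      have := h1 g
      simp only [map_add, map_smul] at this
      simp only [mul_apply_eq_comp, sub_apply, add_apply, smul_apply, one_apply_eq_self, map_add,
        map_smul]
      linear_combination (norm := module) (-(z + 1)) • this
    · ext g
      have := h2 g
      simp only [map_sub, map_smul] at this
      simp only [mul_apply_eq_comp, sub_apply, add_apply, smul_apply, one_apply_eq_self, map_sub,
        map_smul]
      linear_combination (norm := module) (z + 1) • this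
  · rintro ⟨U, hU⟩
    have h1 : (1 - (z + 1) • R) * (U⁻¹ : (H →L[𝕜] H)ˣ) = 1 := by rw [← hU, Units.mul_inv]
    have h2 : (U⁻¹ : (H →L[𝕜] H)ˣ) * (1 - (z + 1) • R) = 1 := by rw [← hU, Units.inv_mul]
    refine ⟨R * (U⁻¹ : (H →L[𝕜] H)ˣ), fun g => ?_, fun g => ?_⟩
    · have := congrArg (fun T : H →L[𝕜] H => T g) h1
      simp only [mul_apply_eq_comp, sub_apply, smul_apply, one_apply_eq_self] at this ⊢
      congr 1
      nth_rw 1 [← this]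
      module
    · have := congrArg (fun T : H →L[𝕜] H => T g) h2
      simp only [mul_apply_eq_comp, sub_apply, smul_apply, one_apply_eq_self] at this ⊢
      rw [this]

theorem mem_eigenspace_iff (z : 𝕜) (u : H) : u ∈ A.eigenspace z ↔ (z + 1) • R u = u := by
  have h1 : u ∈ A.eigenspace z ↔ (u, z • u) ∈ A.graph := by
    rw [LinearPMap.mem_graph_iff]
    constructor
    · rintro ⟨hu, hA⟩
      exact ⟨⟨u, hu⟩, rfl, hA⟩
    · rintro ⟨⟨v, hv⟩, hv', hA⟩
      dsimp only at hv' hA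
      subst hv'
      exact ⟨hv, hA⟩
  rw [h1, h.mem_graph_iff, ← map_smul]
  congr! 2
  module

end IsSymmetricInverseAddOne

open Module.End in
/-- Nonzero eigenvalues of a compact symmetric operator are isolated. -/
theorem IsCompactOperator.eventually_not_hasEigenvalue [CompleteSpace H] {R : H →L[𝕜] H}
    (hR : IsCompactOperator R) (hs : (R : H →ₗ[𝕜] H).IsSymmetric) {l : 𝕜} (hl : l ≠ 0)
    (hev : HasEigenvalue (R : Module.End 𝕜 H) l) :
    ∀ᶠ μ in 𝓝 l, μ ≠ l → ¬ HasEigenvalue (R : Module.End 𝕜 H) μ := by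
  have hs' : ∀ x y, inner 𝕜 (R x) y = inner 𝕜 x (R y) := hs
  have hfd := ContinuousLinearMap.finite_dimensional_eigenspace hR l hl
  set E := eigenspace (R : Module.End 𝕜 H) l
  have hE : ∀ e ∈ E, R e = l • e := fun e he => mem_eigenspace_iff.1 he
  -- Adding the projection `P` removes `l` from the spectrum. Eigenvectors of `R` for other
  -- eigenvalues are orthogonal to `E`, so they stay eigenvectors of `R + P`, and the resolvent set
  -- of `R + P` is open around `l`.
  set P := E.starProjection
  have hPc : IsCompactOperator P := by
    have := FiniteDimensional.proper_rclike 𝕜 E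
    exact (isCompactOperator_of_locallyCompactSpace_rng E.subtypeL).comp_clm
      E.orthogonalProjectionOnto
  have hR'c : IsCompactOperator (R + P : H →L[𝕜] H) := hR.add hPc
  have hlreal : (starRingEnd 𝕜) l = l := hs.conj_eigenvalue_eq_self hev
  have hP0 : ∀ x, (∀ e ∈ E, inner 𝕜 e x = 0) → P x = 0 := fun x hx =>
    (Submodule.starProjection_apply_eq_zero_iff E).2 hx
  have hnot : ¬ HasEigenvalue ((R + P : H →L[𝕜] H) : Module.End 𝕜 H) l := by
    intro hh
    obtain ⟨x, hx⟩ := hh.exists_hasEigenvector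
    have hx1 : R x + P x = l • x := hx.apply_eq_smul
    have hx2 : ∀ e ∈ E, inner 𝕜 e x = 0 := by
      intro e he
      have h1 : inner 𝕜 e (R x + P x) = inner 𝕜 e (l • x) := by rw [hx1]
      have h2 : inner 𝕜 e (P x) = inner 𝕜 e x := by
        have := E.sub_starProjection_mem_orthogonal x e he
        rw [inner_sub_right, sub_eq_zero] at this
        exact this.symm
      rw [inner_add_right, ← hs', hE e he, inner_smul_left, hlreal, inner_smul_right, h2] at h1
      simpa using h1
    have hx3 := hP0 x hx2
    rw [hx3, add_zero] at hx1
    have hx4 : x ∈ E := mem_eigenspace_iff.2 hx1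
    exact hx.2 (inner_self_eq_zero.1 (hx2 x hx4))
  have hres := (hR'c.hasEigenvalue_or_mem_resolventSet hl).resolve_left hnot
  have hopen := (spectrum.isOpen_resolventSet (𝕜 := 𝕜) (R + P)).mem_nhds hres
  have hne : ∀ᶠ μ in 𝓝 l, μ ≠ 0 := isOpen_ne.mem_nhds hl
  filter_upwards [hopen, hne] with μ hμ hμ0 hμl hμev
  obtain ⟨x, hx⟩ := hμev.exists_hasEigenvector
  have hμreal : (starRingEnd 𝕜) μ = μ := hs.conj_eigenvalue_eq_self hμev
  have hx1 : R x = μ • x := hx.apply_eq_smul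
  have hx2 : ∀ e ∈ E, inner 𝕜 e x = 0 := by
    intro e he
    have h1 : inner 𝕜 (R e) x = inner 𝕜 e (R x) := hs' e x
    rw [hE e he, hx1, inner_smul_left, inner_smul_right, hlreal, ← sub_eq_zero, ← sub_mul] at h1
    exact (mul_eq_zero.1 h1).resolve_left (sub_ne_zero.2 hμl.symm)
  have hev' : HasEigenvalue ((R + P : H →L[𝕜] H) : Module.End 𝕜 H) μ := by
    refine hasEigenvalue_of_hasEigenvector (x := x) ⟨mem_eigenspace_iff.2 ?_, hx.2⟩
    change R x + P x = μ • x
    rw [hP0 x hx2, hx1, add_zero]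
  exact (hR'c.hasEigenvalue_iff_mem_spectrum hμ0).1 hev' hμ

namespace IsSymmetricInverseAddOne

variable {A : H →ₗ.[𝕜] H} {R : H →L[𝕜] H} (h : IsSymmetricInverseAddOne A R)

include h

theorem mem_unboundedSpectrum_iff_of_ne {z : 𝕜} (hz : z + 1 ≠ 0) :
    z ∈ A.unboundedSpectrum ↔ (z + 1)⁻¹ ∈ spectrum 𝕜 R := by
  rw [h.mem_unboundedSpectrum_iff, show (1 : H →L[𝕜] H) - (z + 1) • R =
    (z + 1) • (algebraMap 𝕜 (H →L[𝕜] H) (z + 1)⁻¹ - R) by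
      rw [smul_sub, Algebra.algebraMap_eq_smul_one, smul_smul, mul_inv_cancel₀ hz, one_smul],
     spectrum.mem_iff, not_iff_not]
  exact isUnit_smul_iff (Units.mk0 _ hz) _

theorem add_one_ne_zero {z : 𝕜} (hz : z ∈ A.unboundedSpectrum) : z + 1 ≠ 0 := by
  intro h0
  rw [h.mem_unboundedSpectrum_iff, h0] at hz
  simp at hz

theorem eigenspace_eq {z : 𝕜} (hz : z + 1 ≠ 0) :
    A.eigenspace z = Module.End.eigenspace (R : Module.End 𝕜 H) (z + 1)⁻¹ := by
  ext u
  rw [h.mem_eigenspace_iff, Module.End.mem_eigenspace_iff, eq_inv_smul_iff₀ hz]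
  rfl

/-- The map `z ↦ (z + 1)⁻¹` sends the spectrum of `A` to nonzero spectral values of `R`. By the
Fredholm alternative these are eigenvalues of finite multiplicity, and they are isolated. -/
theorem hasPurelyDiscreteSpectrum [CompleteSpace H] (hR : IsCompactOperator R) :
    A.HasPurelyDiscreteSpectrum := by
  refine Set.Subset.antisymm (fun z hz => ?_) fun z hz => hz.1
  have hz1 := h.add_one_ne_zero hz
  have hl : (z + 1)⁻¹ ≠ 0 := inv_ne_zero hz1
  have hev := (hR.hasEigenvalue_iff_mem_spectrum hl).2
    ((h.mem_unboundedSpectrum_iff_of_ne hz1).1 hz)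
  refine ⟨hz, ?_, ?_, ?_⟩
  · rw [accPt_iff_frequently, not_frequently]
    have hc : Tendsto (fun y : 𝕜 => (y + 1)⁻¹) (𝓝 z) (𝓝 (z + 1)⁻¹) :=
      (tendsto_id.add_const 1).inv₀ hz1
    filter_upwards [hc.eventually (hR.eventually_not_hasEigenvalue h.symm hl hev)]
      with y hy ⟨hyz, hyσ⟩
    have hy1 := h.add_one_ne_zero hyσ
    refine hy (fun he => hyz (add_right_cancel (inv_injective he))) ?_
    exact (hR.hasEigenvalue_iff_mem_spectrum (inv_ne_zero hy1)).2
      ((h.mem_unboundedSpectrum_iff_of_ne hy1).1 hyσ)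
  · rw [h.eigenspace_eq hz1]
    exact hev
  · rw [h.eigenspace_eq hz1]
    exact ContinuousLinearMap.finite_dimensional_eigenspace hR _ hl

theorem isBoundedBelow_of_notMem {z : 𝕜} (hz : z + 1 ≠ 0) (hσ : z ∉ A.unboundedSpectrum) :
    IsBoundedBelow (R - (z + 1)⁻¹ • (1 : H →L[𝕜] H)) := by
  rw [h.mem_unboundedSpectrum_iff_of_ne hz, spectrum.notMem_iff] at hσ
  obtain ⟨U, hU⟩ := hσ
  set V : H →L[𝕜] H := ((U⁻¹ : (H →L[𝕜] H)ˣ) : H →L[𝕜] H)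
  refine ⟨(‖V‖ + 1)⁻¹, by positivity, fun x => ?_⟩
  have h1 : V ((algebraMap 𝕜 (H →L[𝕜] H) (z + 1)⁻¹ - R) x) = x := by
    rw [← hU]
    exact congrArg (fun T : H →L[𝕜] H => T x) U.inv_mul
  have h2 : ‖(R - (z + 1)⁻¹ • (1 : H →L[𝕜] H)) x‖ =
      ‖(algebraMap 𝕜 (H →L[𝕜] H) (z + 1)⁻¹ - R) x‖ := by
    rw [← norm_neg, Algebra.algebraMap_eq_smul_one, ← neg_apply, neg_sub]
  rw [h2, inv_mul_le_iff₀ (by positivity)]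
  calc ‖x‖ = ‖V ((algebraMap 𝕜 (H →L[𝕜] H) (z + 1)⁻¹ - R) x)‖ := by rw [h1]
    _ ≤ ‖V‖ * ‖(algebraMap 𝕜 (H →L[𝕜] H) (z + 1)⁻¹ - R) x‖ := V.le_opNorm _
    _ ≤ _ := by gcongr; linarith

/-- The point is `z = l⁻¹ - 1`, with `l` from `exists_essential_approximate_eigenvalue`. If `z` were
not essential, `R - l` would be bounded below off a finite-dimensional `E`: off the eigenspace if
`z` is in the discrete spectrum, everywhere if `z` is in the resolvent set. This contradicts the
choice of `l`. -/
theorem essentialSpectrum_nonempty [CompleteSpace H] {φ : ℕ → H} (hφ : Orthonormal 𝕜 φ) {c₀ : ℝ}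
    (hc₀ : 0 < c₀) (hRφ : ∀ n, c₀ ≤ RCLike.re (inner 𝕜 (R (φ n)) (φ n))) :
    A.essentialSpectrum.Nonempty := by
  obtain ⟨l, hl, happ⟩ := exists_essential_approximate_eigenvalue h.symm hφ hc₀ hRφ
  suffices hz : ((l : 𝕜)⁻¹ - 1) ∈ A.essentialSpectrum from ⟨_, hz⟩
  set z : 𝕜 := (l : 𝕜)⁻¹ - 1
  have hl' : (l : 𝕜) ≠ 0 := RCLike.ofReal_ne_zero.2 hl.ne'
  have hz1 : z + 1 = (l : 𝕜)⁻¹ := sub_add_cancel _ _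
  have hz0 : z + 1 ≠ 0 := by rw [hz1]; exact inv_ne_zero hl'
  have hzi : (z + 1)⁻¹ = (l : 𝕜) := by rw [hz1, inv_inv]
  by_contra hess
  suffices hE : ∃ E : Submodule 𝕜 H, FiniteDimensional 𝕜 E ∧ ∃ d > (0 : ℝ),
      ∀ x ∈ Eᗮ, d * ‖x‖ ≤ ‖R x - (l : 𝕜) • x‖ by
    obtain ⟨E, hE, d, hd, hlow⟩ := hE
    obtain ⟨x, hx, hlt⟩ := happ E hE d hd
    exact absurd (hlow x hx) (not_le.2 hlt)
  by_cases hσ : z ∈ A.unboundedSpectrum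
  · have hdisc : z ∈ A.discreteSpectrum := by
      by_contra hd
      exact hess ⟨hσ, hd⟩
    obtain ⟨-, hacc, -, hfd⟩ := hdisc
    refine ⟨A.eigenspace z, hfd, ?_⟩
    rw [accPt_iff_frequently, not_frequently] at hacc
    have hc : Tendsto (fun μ : ℝ => ((l + μ : ℝ) : 𝕜)⁻¹ - 1) (𝓝 0) (𝓝 z) := by
      have h1 : Tendsto (fun μ : ℝ => ((l + μ : ℝ) : 𝕜)) (𝓝 0) (𝓝 (l : 𝕜)) := by
        have : Continuous (fun μ : ℝ => ((l + μ : ℝ) : 𝕜)) := by fun_prop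
        simpa using this.tendsto 0
      exact (h1.inv₀ hl').sub_const 1
    -- Isolation of `z` becomes a gap of the spectrum of `R` around `l`. The second condition keeps
    -- `l + μ` positive, so that `(l + μ)⁻¹ - 1` corresponds to it.
    obtain ⟨δ, hδ, hδ'⟩ := Metric.eventually_nhds_iff.1
      ((hc.eventually hacc).and (eventually_gt_nhds (show -l < 0 by linarith)))
    set T : H →L[𝕜] H := R - (l : 𝕜) • (1 : H →L[𝕜] H)
    have hTs := isSymmetric_sub_smul h.symm l
    have hgap : ∀ μ : ℝ, μ ≠ 0 → |μ| < δ → IsBoundedBelow (T - (μ : 𝕜) • (1 : H →L[𝕜] H)) := by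
      intro μ hμ hμδ
      obtain ⟨h1, h2⟩ := hδ' (show dist μ 0 < δ by simpa using hμδ)
      have hpos : 0 < l + μ := by linarith
      have hne : ((l + μ : ℝ) : 𝕜) ≠ 0 := RCLike.ofReal_ne_zero.2 hpos.ne'
      have hyz : ((l + μ : ℝ) : 𝕜)⁻¹ - 1 ≠ z := by
        intro he
        have := inv_injective (sub_left_injective he)
        rw [RCLike.ofReal_inj] at this
        exact hμ (by linarith)
      have h3 := h.isBoundedBelow_of_notMem (z := ((l + μ : ℝ) : 𝕜)⁻¹ - 1)
        (by rw [sub_add_cancel]; exact inv_ne_zero hne) (fun hy => h1 ⟨hyz, hy⟩)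
      rw [sub_add_cancel, inv_inv] at h3
      convert h3 using 1
      simp only [T]
      push_cast
      module
    refine ⟨δ, hδ, fun x hx => ?_⟩
    have h4 := mul_norm_le_norm_apply_of_mem_orthogonal_ker hTs
      (mul_norm_apply_le_norm_apply_apply hTs hδ hgap) (x := x) (by
        rw [h.eigenspace_eq hz0, hzi] at hx
        convert hx using 2
        ext y
        rw [LinearMap.mem_ker, Module.End.mem_eigenspace_iff]
        exact sub_eq_zero)
    exact h4
  · obtain ⟨d, hd, hlow⟩ := h.isBoundedBelow_of_notMem hz0 hσ
    rw [hzi] at hlow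
    exact ⟨⊥, inferInstance, d, hd, fun x _ => hlow x⟩

end IsSymmetricInverseAddOne

end ShiftedResolvent

/-! ### The operator of a closed form. -/

section FormOperators

variable {𝕜 H : Type*} [RCLike 𝕜] [NormedAddCommGroup H] [InnerProductSpace 𝕜 H] [CompleteSpace H]

/-- The operator `ι ι*` for the embedding `ι` of a closed form domain. -/
def formResolvent (K : Submodule 𝕜 (WithLp 2 (H × H))) [CompleteSpace K] : H →L[𝕜] H :=
  (formEmbedding K).comp (formEmbedding K).adjoint

theorem inner_formResolvent (K : Submodule 𝕜 (WithLp 2 (H × H))) [CompleteSpace K] (x y : H) :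
    inner 𝕜 (formResolvent K x) y =
      inner 𝕜 ((formEmbedding K).adjoint x) ((formEmbedding K).adjoint y) := by
  rw [formResolvent, ContinuousLinearMap.comp_apply, ← ContinuousLinearMap.adjoint_inner_right]

/-- A closed form whose domain is dense gives the operator with `(A + 1)⁻¹ = ι ι*`. -/
theorem isSymmetricInverseAddOne_formResolvent (K : Submodule 𝕜 (WithLp 2 (H × H)))
    [CompleteSpace K] (hinj : ∀ g ∈ K, g.fst = 0 → g.snd = 0)
    (hdense : ∀ w : H, (∀ g ∈ K, inner 𝕜 g.fst w = 0) → w = 0) :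
    IsSymmetricInverseAddOne (formOperator K) (formResolvent K) := by
  set ι := formEmbedding K
  have hι : ∀ g : K, ι g = g.1.fst := fun g => rfl
  have hadj : ∀ (g : K) (x : H), inner 𝕜 g (ι.adjoint x) = inner 𝕜 g.1.fst x := fun g x => by
    rw [ContinuousLinearMap.adjoint_inner_right, hι]
  have hK : ∀ f g : K, inner 𝕜 g f = inner 𝕜 g.1.fst f.1.fst + inner 𝕜 g.1.snd f.1.snd :=
    fun f g => WithLp.prod_inner_apply _ _
  -- The relation is single-valued: `f = 0` forces `f' = 0`, and then the second component is
  -- orthogonal to the dense form domain.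
  have hgraph : ∀ p ∈ formGraph K, p.1 = 0 → p.2 = 0 := by
    rintro p ⟨f, hf, hfp, hp⟩ h0
    refine hdense _ fun g hg => ?_
    rw [← hp g hg, hinj f hf (hfp.trans h0), inner_zero_right]
  refine ⟨fun x y => ?_, fun x hx => ?_, fun u w => ?_⟩
  · simp only [ContinuousLinearMap.coe_coe]
    rw [inner_formResolvent, ← inner_conj_symm x, inner_formResolvent, inner_conj_symm]
  · have h1 : ι.adjoint x = 0 := by
      rw [← inner_self_eq_zero (𝕜 := 𝕜), ← inner_formResolvent, hx, inner_zero_left]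
    refine hdense x fun g hg => ?_
    rw [← hadj ⟨g, hg⟩, h1, inner_zero_right]
  -- Adding `⟪g, u⟫` to both sides of the form equation turns it into `⟪g, f⟫_K = ⟪ι g, w + u⟫` for
  -- all `g`, that is, `f = ι* (w + u)`.
  · rw [formOperator, Submodule.toLinearPMap_graph_eq _ hgraph]
    constructor
    · rintro ⟨f, hf, hfu, hfw⟩
      dsimp only at hfu hfw
      have h1 : (⟨f, hf⟩ : K) = ι.adjoint (w + u) := by
        refine ext_inner_left 𝕜 fun g => ?_
        rw [hadj, hK, hfw _ g.2, ← hfu, inner_add_right, add_comm]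
      change ι (ι.adjoint (w + u)) = u
      rw [← h1]
      exact hfu
    · intro hu
      refine ⟨ι.adjoint (w + u), Submodule.coe_mem _, hu, fun g hg => ?_⟩
      have h1 := hadj ⟨g, hg⟩ (w + u)
      rw [hK] at h1
      have h2 : (ι.adjoint (w + u) : WithLp 2 (H × H)).fst = u := hu
      dsimp only at h1 ⊢
      rw [h2, inner_add_right, add_comm] at h1
      exact add_right_cancel h1

theorem isCompactOperator_formResolvent (K : Submodule 𝕜 (WithLp 2 (H × H))) [CompleteSpace K]
    (hK : IsCompactOperator (formEmbedding K)) : IsCompactOperator (formResolvent K) :=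
  hK.comp_clm _

/-- On the form domain the form of `ι ι*` is bounded below by the norm of the embedding. -/
theorem le_inner_formResolvent (K : Submodule 𝕜 (WithLp 2 (H × H))) [CompleteSpace K] (f : K)
    {C : ℝ} (hC : 0 < C) (hf : ‖f‖ ≤ C) (h1 : ‖formEmbedding K f‖ = 1) :
    (C ^ 2)⁻¹ ≤ RCLike.re
      (inner 𝕜 (formResolvent K (formEmbedding K f)) (formEmbedding K f)) := by
  set ι := formEmbedding K
  rw [inner_formResolvent, inner_self_eq_norm_sq, ← inv_pow]
  refine pow_le_pow_left₀ (by positivity) ?_ 2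
  rw [inv_le_iff_one_le_mul₀ hC, mul_comm]
  calc (1 : ℝ) = RCLike.re (inner 𝕜 (ι f) (ι f)) := by rw [inner_self_eq_norm_sq, h1, one_pow]
    _ = RCLike.re (inner 𝕜 f (ι.adjoint (ι f))) := by
      rw [ContinuousLinearMap.adjoint_inner_right]
    _ ≤ ‖f‖ * ‖ι.adjoint (ι f)‖ := re_inner_le_norm _ _
    _ ≤ _ := by gcongr

end FormOperators

/-! ### The fundamental theorem of calculus for vector-valued absolutely continuous functions. -/

section AbsolutelyContinuous

theorem AbsolutelyContinuousOnInterval.of_dist_le {X Y : Type*} [PseudoMetricSpace X]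
    [PseudoMetricSpace Y] {f : ℝ → X} {g : ℝ → Y} {a b : ℝ}
    (hg : AbsolutelyContinuousOnInterval g a b)
    (h : ∀ x ∈ uIcc a b, ∀ y ∈ uIcc a b, dist (f x) (f y) ≤ dist (g x) (g y)) :
    AbsolutelyContinuousOnInterval f a b := by
  rw [absolutelyContinuousOnInterval_iff] at hg ⊢
  intro ε hε
  obtain ⟨δ, hδ, hg⟩ := hg ε hε
  refine ⟨δ, hδ, fun E hE hlt => lt_of_le_of_lt ?_ (hg E hE hlt)⟩
  exact Finset.sum_le_sum fun i hi => h _ (hE.1 i hi).1 _ (hE.1 i hi).2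

variable {F : Type*} [NormedAddCommGroup F] [NormedSpace ℝ F]

theorem IntervalIntegrable.absolutelyContinuousOnInterval_integral {f : ℝ → F} {a b : ℝ}
    (hf : IntervalIntegrable f volume a b) :
    AbsolutelyContinuousOnInterval (fun x => ∫ t in a..x, f t) a b := by
  refine AbsolutelyContinuousOnInterval.of_dist_le
    (hf.norm.absolutelyContinuousOnInterval_intervalIntegral (c := a) left_mem_uIcc) ?_
  intro x hx y hy
  have hx' : IntervalIntegrable f volume a x := hf.mono_set (uIcc_subset_uIcc_left hx)
  have hy' : IntervalIntegrable f volume a y := hf.mono_set (uIcc_subset_uIcc_left hy)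
  rw [dist_eq_norm, dist_eq_norm, intervalIntegral.integral_interval_sub_left hx' hy',
    intervalIntegral.integral_interval_sub_left hx'.norm hy'.norm]
  exact intervalIntegral.norm_integral_le_abs_integral_norm

/-- The difference of `f` and the primitive of `f'` is absolutely continuous with derivative 0
almost everywhere, hence constant. -/
theorem AbsolutelyContinuousOnInterval.integral_eq_sub_of_ae_hasDerivAt [CompleteSpace F]
    {f f' : ℝ → F} {a b : ℝ} (hf : AbsolutelyContinuousOnInterval f a b)
    (hint : IntervalIntegrable f' volume a b)
    (hd : ∀ᵐ x, x ∈ uIcc a b → HasDerivAt f (f' x) x) {x : ℝ} (hx : x ∈ uIcc a b) :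
    ∫ t in a..x, f' t = f x - f a := by
  have h1 : AbsolutelyContinuousOnInterval (fun x => f x - ∫ t in a..x, f' t) a b :=
    hf.sub hint.absolutelyContinuousOnInterval_integral
  obtain ⟨C, hC⟩ := h1.const_of_ae_hasDerivAt_zero (by
    filter_upwards [hd, hint.ae_hasDerivAt_integral] with y h2 h3 hy
    have h4 := (h2 hy).fun_sub (h3 hy a left_mem_uIcc)
    rwa [sub_self] at h4)
  have h4 := hC x hx
  have h5 := hC a left_mem_uIcc
  simp only [intervalIntegral.integral_same, sub_zero] at h5
  rw [h5, ← h4]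
  abel

end AbsolutelyContinuous

/-! ### Sobolev, Poincaré and Rellich estimates on one edge. -/

section Edge

variable {𝕜 : Type*} [RCLike 𝕜]

/-- The space `L²(0, ℓ)` of an edge of length `ℓ`. -/
abbrev EdgeL2 (𝕜 : Type*) [RCLike 𝕜] (ℓ : ℝ) : Type _ :=
  Lp 𝕜 2 ((volume : Measure ℝ).restrict (Icc 0 ℓ))

/-- `f` is a function in `H¹(0, ℓ)` with class `u` and derivative `v`. -/
structure IsEdgeRep (ℓ : ℝ) (f : ℝ → 𝕜) (u v : EdgeL2 𝕜 ℓ) : Prop where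
  ac : AbsolutelyContinuousOnInterval f 0 ℓ
  eq_ae : ∀ᵐ x ∂((volume : Measure ℝ).restrict (Icc 0 ℓ)), u x = f x
  deriv_ae : ∀ᵐ x ∂((volume : Measure ℝ).restrict (Icc 0 ℓ)), HasDerivAt f (v x) x

theorem EdgeL2.intervalIntegrable {ℓ : ℝ} (hℓ : 0 < ℓ) (v : EdgeL2 𝕜 ℓ) :
    IntervalIntegrable v volume 0 ℓ := by
  rw [intervalIntegrable_iff_integrableOn_Icc_of_le hℓ.le]
  exact (Lp.memLp v).integrable one_le_two

theorem EdgeL2.intervalIntegrable_of_mem {ℓ : ℝ} (hℓ : 0 < ℓ) (v : EdgeL2 𝕜 ℓ) {x y : ℝ}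
    (hx : x ∈ Icc 0 ℓ) (hy : y ∈ Icc 0 ℓ) : IntervalIntegrable v volume x y := by
  refine (v.intervalIntegrable hℓ).mono_set ?_
  rw [uIcc_of_le hℓ.le]
  exact uIcc_subset_Icc hx hy

theorem EdgeL2.norm_sq_eq_integral {ℓ : ℝ} (u : EdgeL2 𝕜 ℓ) :
    ‖u‖ ^ 2 = ∫ x in Icc 0 ℓ, ‖u x‖ ^ 2 := by
  rw [← inner_self_eq_norm_sq (𝕜 := 𝕜), L2.inner_def, ← integral_re (L2.integrable_inner u u)]
  simp only [inner_self_eq_norm_sq]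

/-- As an inner product, the integral is continuous in `u`, obeys the Cauchy–Schwarz inequality, and
its vanishing is an orthogonality condition; all three are used. -/
theorem EdgeL2.inner_indicator {ℓ : ℝ} (u : EdgeL2 𝕜 ℓ) {x y : ℝ} (h0 : 0 ≤ x) (hxy : x ≤ y)
    (hy : y ≤ ℓ) :
    inner 𝕜 (indicatorConstLp 2 (measurableSet_Icc (a := x) (b := y))
      (measure_ne_top ((volume : Measure ℝ).restrict (Icc 0 ℓ)) _) (1 : 𝕜)) u =
        ∫ t in x..y, u t := by
  rw [L2.inner_indicatorConstLp_one, Measure.restrict_restrict measurableSet_Icc,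
    inter_eq_left.2 (Icc_subset_Icc h0 hy), intervalIntegral.integral_of_le hxy,
    integral_Icc_eq_integral_Ioc]

theorem EdgeL2.norm_integral_sq_le {ℓ : ℝ} (v : EdgeL2 𝕜 ℓ) {x y : ℝ} (h0 : 0 ≤ x)
    (hxy : x ≤ y) (hy : y ≤ ℓ) : ‖∫ t in x..y, v t‖ ^ 2 ≤ (y - x) * ‖v‖ ^ 2 := by
  rw [← v.inner_indicator h0 hxy hy]
  have h1 := norm_inner_le_norm (𝕜 := 𝕜) (indicatorConstLp 2 (measurableSet_Icc (a := x) (b := y))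
      (measure_ne_top ((volume : Measure ℝ).restrict (Icc 0 ℓ)) _) (1 : 𝕜)) v
  have h2 : ‖indicatorConstLp 2 (measurableSet_Icc (a := x) (b := y))
      (measure_ne_top ((volume : Measure ℝ).restrict (Icc 0 ℓ)) _) (1 : 𝕜)‖ = √(y - x) := by
    rw [norm_indicatorConstLp two_ne_zero ENNReal.ofNat_ne_top, norm_one, one_mul, measureReal_def,
      Measure.restrict_apply measurableSet_Icc, inter_eq_left.2 (Icc_subset_Icc h0 hy),
      Real.volume_Icc, ENNReal.toReal_ofReal (sub_nonneg.2 hxy), Real.sqrt_eq_rpow]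
    norm_num
  rw [h2] at h1
  calc _ ≤ (√(y - x) * ‖v‖) ^ 2 := pow_le_pow_left₀ (norm_nonneg _) h1 2
    _ = _ := by rw [mul_pow, Real.sq_sqrt (sub_nonneg.2 hxy)]

/-- Converse to `sub_eq_integral`. Unlike differentiability almost everywhere, the integrated
identity passes to limits, which is what closedness of the form needs. -/
theorem IsEdgeRep.of_integral {ℓ : ℝ} (hℓ : 0 < ℓ) {f : ℝ → 𝕜} {u v : EdgeL2 𝕜 ℓ}
    (hu : ∀ᵐ x ∂((volume : Measure ℝ).restrict (Icc 0 ℓ)), u x = f x)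
    (hv : ∀ x ∈ Icc 0 ℓ, f x - f 0 = ∫ t in (0 : ℝ)..x, v t) : IsEdgeRep ℓ f u v := by
  refine ⟨?_, hu, ?_⟩
  · refine (v.intervalIntegrable hℓ).absolutelyContinuousOnInterval_integral.of_dist_le ?_
    rw [uIcc_of_le hℓ.le]
    intro x hx y hy
    rw [← hv x hx, ← hv y hy, dist_sub_right]
  · have h1 := (v.intervalIntegrable hℓ).ae_hasDerivAt_integral
    -- `f` agrees with the primitive only on `[0, ℓ]`, so two-sided derivatives are available only
    -- in the interior.
    have h2 : ∀ᵐ x : ℝ, x ≠ 0 ∧ x ≠ ℓ := by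
      filter_upwards [Measure.ae_ne volume (0 : ℝ), Measure.ae_ne volume ℓ] with x h h'
      exact ⟨h, h'⟩
    rw [ae_restrict_iff' measurableSet_Icc]
    filter_upwards [h1, h2] with x hx hne hxI
    have h3 := hx (by rwa [uIcc_of_le hℓ.le]) 0 left_mem_uIcc
    have hxo : x ∈ Ioo 0 ℓ := ⟨lt_of_le_of_ne hxI.1 hne.1.symm, lt_of_le_of_ne hxI.2 hne.2⟩
    refine (h3.const_add (f 0)).congr_of_eventuallyEq ?_
    filter_upwards [isOpen_Ioo.mem_nhds hxo] with y hy
    rw [← hv y (Ioo_subset_Icc_self hy), add_sub_cancel]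

namespace IsEdgeRep

variable {ℓ : ℝ} {f : ℝ → 𝕜} {u v : EdgeL2 𝕜 ℓ}

theorem sub_eq_integral (h : IsEdgeRep ℓ f u v) (hℓ : 0 < ℓ) {x : ℝ} (hx : x ∈ Icc 0 ℓ) :
    f x - f 0 = ∫ t in (0 : ℝ)..x, v t := by
  refine (h.ac.integral_eq_sub_of_ae_hasDerivAt (v.intervalIntegrable hℓ) ?_ ?_).symm
  · rw [uIcc_of_le hℓ.le]
    exact (ae_restrict_iff' measurableSet_Icc).1 h.deriv_ae
  · rwa [uIcc_of_le hℓ.le]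

theorem norm_sub_sq_le (h : IsEdgeRep ℓ f u v) (hℓ : 0 < ℓ) {x y : ℝ} (hx : x ∈ Icc 0 ℓ)
    (hy : y ∈ Icc 0 ℓ) : ‖f y - f x‖ ^ 2 ≤ |y - x| * ‖v‖ ^ 2 := by
  wlog hxy : x ≤ y generalizing x y
  · rw [norm_sub_rev, abs_sub_comm]
    exact this hy hx (le_of_not_ge hxy)
  have h1 : f y - f x = ∫ t in x..y, v t := by
    rw [← intervalIntegral.integral_interval_sub_left
      (v.intervalIntegrable_of_mem hℓ (left_mem_Icc.2 hℓ.le) hy)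
      (v.intervalIntegrable_of_mem hℓ (left_mem_Icc.2 hℓ.le) hx),
      ← h.sub_eq_integral hℓ hy, ← h.sub_eq_integral hℓ hx]
    abel
  rw [h1, abs_of_nonneg (sub_nonneg.2 hxy)]
  exact v.norm_integral_sq_le hx.1 hxy hy.2

theorem norm_sub_sq_le_length (h : IsEdgeRep ℓ f u v) (hℓ : 0 < ℓ) {x y : ℝ} (hx : x ∈ Icc 0 ℓ)
    (hy : y ∈ Icc 0 ℓ) : ‖f y - f x‖ ^ 2 ≤ ℓ * ‖v‖ ^ 2 :=
  (h.norm_sub_sq_le hℓ hx hy).trans (by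
    gcongr
    exact abs_sub_le_iff.2 ⟨by linarith [hx.1, hy.2], by linarith [hx.2, hy.1]⟩)

theorem norm_sq_le_add (h : IsEdgeRep ℓ f u v) (hℓ : 0 < ℓ) {x y : ℝ} (hx : x ∈ Icc 0 ℓ)
    (hy : y ∈ Icc 0 ℓ) : ‖f y‖ ^ 2 ≤ 2 * ‖f x‖ ^ 2 + 2 * (ℓ * ‖v‖ ^ 2) := by
  have h1 := h.norm_sub_sq_le_length hℓ hx hy
  have h2 : ‖f y‖ ≤ ‖f x‖ + ‖f y - f x‖ := by
    simpa using norm_add_le (f x) (f y - f x)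
  nlinarith [sq_nonneg (‖f x‖ - ‖f y - f x‖), norm_nonneg (f y)]

theorem norm_sq_eq (h : IsEdgeRep ℓ f u v) : ‖u‖ ^ 2 = ∫ x in Icc 0 ℓ, ‖f x‖ ^ 2 := by
  rw [u.norm_sq_eq_integral]
  refine integral_congr_ae ?_
  filter_upwards [h.eq_ae] with x hx
  rw [hx]

theorem integrable_norm_sq (h : IsEdgeRep ℓ f u v) :
    IntegrableOn (fun x => ‖f x‖ ^ 2) (Icc 0 ℓ) := by
  have h1 : Integrable (fun x => ‖u x‖ ^ 2) ((volume : Measure ℝ).restrict (Icc 0 ℓ)) :=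
    (Lp.memLp u).integrable_norm_pow two_ne_zero
  refine h1.congr ?_
  filter_upwards [h.eq_ae] with x hx
  rw [hx]

theorem norm_sq_le_of_le (h : IsEdgeRep ℓ f u v) (hℓ : 0 < ℓ) {C : ℝ}
    (hC : ∀ x ∈ Icc 0 ℓ, ‖f x‖ ^ 2 ≤ C) : ‖u‖ ^ 2 ≤ ℓ * C := by
  rw [h.norm_sq_eq]
  have h1 := setIntegral_mono_on h.integrable_norm_sq
    (integrableOn_const (C := C) (by simp)) measurableSet_Icc hC
  rw [setIntegral_const, measureReal_def, Real.volume_Icc,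
    ENNReal.toReal_ofReal (by linarith), sub_zero, smul_eq_mul] at h1
  exact h1

theorem le_norm_sq_of_le (h : IsEdgeRep ℓ f u v) (hℓ : 0 < ℓ) {C : ℝ}
    (hC : ∀ x ∈ Icc 0 ℓ, C ≤ ‖f x‖ ^ 2) : ℓ * C ≤ ‖u‖ ^ 2 := by
  rw [h.norm_sq_eq]
  have h1 := setIntegral_mono_on (integrableOn_const (C := C) (by simp))
    h.integrable_norm_sq measurableSet_Icc hC
  rw [setIntegral_const, measureReal_def, Real.volume_Icc,
    ENNReal.toReal_ofReal (by linarith), sub_zero, smul_eq_mul] at h1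
  exact h1

/-- The norm of a function on an edge is controlled by one value and the derivative. -/
theorem norm_sq_le (h : IsEdgeRep ℓ f u v) (hℓ : 0 < ℓ) {x : ℝ} (hx : x ∈ Icc 0 ℓ) :
    ‖u‖ ^ 2 ≤ 2 * (ℓ * ‖f x‖ ^ 2) + 2 * (ℓ ^ 2 * ‖v‖ ^ 2) := by
  refine (h.norm_sq_le_of_le hℓ fun y hy => h.norm_sq_le_add hℓ hx hy).trans_eq ?_
  ring

/-- A value of a function on an edge is controlled by its norm and the derivative. -/
theorem length_mul_norm_sq_le (h : IsEdgeRep ℓ f u v) (hℓ : 0 < ℓ) {x : ℝ} (hx : x ∈ Icc 0 ℓ) :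
    ℓ * ‖f x‖ ^ 2 ≤ 2 * ‖u‖ ^ 2 + 2 * (ℓ ^ 2 * ‖v‖ ^ 2) := by
  have h1 := h.le_norm_sq_of_le hℓ (C := ‖f x‖ ^ 2 / 2 - ℓ * ‖v‖ ^ 2) fun y hy => by
    linarith [h.norm_sq_le_add hℓ hy hx]
  linarith [show ℓ * (‖f x‖ ^ 2 / 2 - ℓ * ‖v‖ ^ 2) = ℓ * ‖f x‖ ^ 2 / 2 - ℓ ^ 2 * ‖v‖ ^ 2 by ring]

theorem integral_eq (h : IsEdgeRep ℓ f u v) {x y : ℝ} (h0 : 0 ≤ x) (hxy : x ≤ y)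
    (hy : y ≤ ℓ) : ∫ t in x..y, u t = ∫ t in x..y, f t := by
  refine intervalIntegral.integral_congr_ae ?_
  filter_upwards [(ae_restrict_iff' measurableSet_Icc).1 h.eq_ae] with t ht htI
  rw [uIoc_of_le hxy] at htI
  exact ht ⟨h0.trans htI.1.le, htI.2.trans hy⟩

/-- Poincaré's inequality for a function of mean `0` on a part of the edge. -/
theorem norm_sq_le_of_integral_eq_zero (h : IsEdgeRep ℓ f u v) (hℓ : 0 < ℓ) {a b x : ℝ}
    (h0 : 0 ≤ a) (hab : a < b) (hb : b ≤ ℓ) (hint : ∫ t in a..b, f t = 0) (hx : x ∈ Icc a b) :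
    ‖f x‖ ^ 2 ≤ (b - a) * ‖v‖ ^ 2 := by
  have hsub : Icc a b ⊆ Icc 0 ℓ := Icc_subset_Icc h0 hb
  have hbound : ∀ t ∈ Icc a b, ‖f x - f t‖ ≤ √((b - a) * ‖v‖ ^ 2) := by
    intro t ht
    refine Real.le_sqrt_of_sq_le ((h.norm_sub_sq_le hℓ (hsub ht) (hsub hx)).trans ?_)
    gcongr
    exact abs_sub_le_iff.2 ⟨by linarith [ht.1, hx.2], by linarith [ht.2, hx.1]⟩
  have hcont : ContinuousOn f (Icc a b) := by
    refine h.ac.continuousOn.mono ?_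
    rwa [uIcc_of_le hℓ.le]
  have hfi : IntervalIntegrable f volume a b := by
    apply ContinuousOn.intervalIntegrable
    rwa [uIcc_of_le hab.le]
  -- As `f` has mean 0, `f x` is the mean of `f x - f t`, and the Hölder bound applies to each
  -- difference.
  have h1 : ∫ t in a..b, (f x - f t) = ((b - a : ℝ) : 𝕜) * f x := by
    rw [intervalIntegral.integral_sub intervalIntegrable_const hfi, hint,
      intervalIntegral.integral_const, sub_zero, RCLike.real_smul_eq_coe_mul]
  have h2 := intervalIntegral.norm_integral_le_of_norm_le_const (a := a) (b := b)
    (f := fun t => f x - f t) fun t ht => hbound t (by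
      rw [uIoc_of_le hab.le] at ht
      exact Ioc_subset_Icc_self ht)
  rw [h1, norm_mul, RCLike.norm_ofReal, abs_of_pos (sub_pos.2 hab), mul_comm] at h2
  have h3 := le_of_mul_le_mul_right h2 (sub_pos.2 hab)
  rw [← Real.sq_sqrt (show 0 ≤ (b - a) * ‖v‖ ^ 2 from
    mul_nonneg (sub_pos.2 hab).le (sq_nonneg _))]
  exact pow_le_pow_left₀ (norm_nonneg _) h3 2

end IsEdgeRep

/-- Rellich's theorem on an interval, in the form of a Poincaré inequality on a space of finite
codimension. -/
theorem exists_finite_norm_sq_le_of_inner_eq_zero {ℓ : ℝ} (hℓ : 0 < ℓ) {ε : ℝ} (hε : 0 < ε) :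
    ∃ s : Set (EdgeL2 𝕜 ℓ), s.Finite ∧ ∀ (f : ℝ → 𝕜) (u v : EdgeL2 𝕜 ℓ), IsEdgeRep ℓ f u v →
      (∀ a ∈ s, inner 𝕜 a u = 0) → ‖u‖ ^ 2 ≤ ε * ‖v‖ ^ 2 := by
  -- Cut the edge into `M` pieces of length `d = ℓ / M` and require mean 0 on each. Then `‖f x‖² ≤ d
  -- ‖v‖²` everywhere, and integration gives the factor `ℓ d = ℓ² / M ≤ ε`.
  obtain ⟨M, hM⟩ := exists_nat_gt (ℓ ^ 2 / ε)
  have hM0 : (0 : ℝ) < M := lt_of_le_of_lt (by positivity) hM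
  set d := ℓ / M
  have hd : 0 < d := div_pos hℓ hM0
  have hMd : M * d = ℓ := mul_div_cancel₀ _ hM0.ne'
  set A : ℕ → EdgeL2 𝕜 ℓ := fun i =>
    indicatorConstLp 2 (measurableSet_Icc (a := (i : ℝ) * d) (b := ((i : ℝ) + 1) * d))
      (measure_ne_top ((volume : Measure ℝ).restrict (Icc 0 ℓ)) _) (1 : 𝕜)
  refine ⟨A '' Iio M, (finite_Iio M).image A, fun f u v h hs => ?_⟩
  have h1 : ∀ x ∈ Icc 0 ℓ, ‖f x‖ ^ 2 ≤ d * ‖v‖ ^ 2 := by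
    intro x hx
    obtain ⟨i, hi, hxi⟩ : ∃ i < M, x ∈ Icc ((i : ℝ) * d) (((i : ℝ) + 1) * d) := by
      -- At `x = ℓ` the floor of `x / d` would be `M`, one too many; the last piece serves instead.
      rcases hx.2.eq_or_lt with rfl | hlt
      · obtain ⟨k, rfl⟩ := Nat.exists_eq_succ_of_ne_zero (n := M) (by rintro rfl; simp at hM0)
        refine ⟨k, Nat.lt_succ_self k, ?_, ?_⟩
        · rw [← hMd]
          gcongr
          simp
        · rw [← hMd]
          push_cast
          exact le_rfl
      · have hxd : 0 ≤ x / d := div_nonneg hx.1 hd.le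
        refine ⟨⌊x / d⌋₊, ?_, ?_, ?_⟩
        · rw [Nat.floor_lt hxd, div_lt_iff₀ hd, hMd]
          exact hlt
        · rw [← le_div_iff₀ hd]
          exact Nat.floor_le hxd
        · rw [← div_le_iff₀ hd]
          exact (Nat.lt_floor_add_one _).le
    have hle : ((i : ℝ) + 1) * d ≤ ℓ := by
      rw [← hMd]
      gcongr
      exact_mod_cast hi
    have hlt : (i : ℝ) * d < ((i : ℝ) + 1) * d := by gcongr; linarith
    have h0 : 0 ≤ (i : ℝ) * d := by positivity
    have hA := hs (A i) (mem_image_of_mem A hi)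
    rw [EdgeL2.inner_indicator u h0 hlt.le hle, h.integral_eq h0 hlt.le hle] at hA
    have := h.norm_sq_le_of_integral_eq_zero hℓ h0 hlt hle hA hxi
    rwa [show ((i : ℝ) + 1) * d - i * d = d by ring] at this
  refine (h.norm_sq_le_of_le hℓ h1).trans ?_
  rw [← mul_assoc]
  gcongr
  rw [← mul_div_assoc, div_le_iff₀ hM0, mul_comm ε, ← div_le_iff₀ hε, ← sq]
  exact hM.le

end Edge

/-! ### Sobolev spaces on a metric graph: closedness and density. -/

namespace MetricGraph

variable {G : MetricGraph} {𝕜 : Type*} [RCLike 𝕜]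

theorem continuous_pt (e : G.Edge) : Continuous (G.pt e) :=
  continuous_quot_mk.comp (continuous_sigmaMk.comp continuous_projIcc)

theorem pt_of_mem (e : G.Edge) (x : Icc (0 : ℝ) (G.len e)) :
    G.pt e x = Quot.mk G.Glue ⟨e, x⟩ := by
  rw [pt, projIcc_val]

theorem exists_eq_pt (p : G.Space) : ∃ e, ∃ x ∈ Icc (0 : ℝ) (G.len e), p = G.pt e x := by
  obtain ⟨⟨e, x⟩, rfl⟩ := Quot.exists_rep p
  exact ⟨e, x, x.2, (pt_of_mem e x).symm⟩

namespace IsH1Rep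

variable {f : G.Space → 𝕜} {u v : G.L2 𝕜}

theorem isEdgeRep (h : IsH1Rep f u v) (e : G.Edge) :
    IsEdgeRep (G.len e) (fun x => f (G.pt e x)) (u e) (v e) :=
  ⟨h.ac e, h.eq_ae e, h.deriv_ae e⟩

theorem sub {g : G.Space → 𝕜} {u' v' : G.L2 𝕜} (hf : IsH1Rep f u v) (hg : IsH1Rep g u' v') :
    IsH1Rep (fun p => f p - g p) (u - u') (v - v') := by
  have := hf.add (hg.smul (-1))
  simpa [sub_eq_add_neg] using this

end IsH1Rep

theorem hasSum_norm_sq (u : G.L2 𝕜) : HasSum (fun e => ‖u e‖ ^ 2) (‖u‖ ^ 2) := by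
  have := lp.hasSum_norm (p := 2) (by norm_num) u
  simpa using this

/-- The derivative of an `H¹` function is determined by its class. -/
theorem IsH1Rep.eq_zero_of_eq_zero {f : G.Space → 𝕜} {v : G.L2 𝕜} (h : IsH1Rep f 0 v) :
    v = 0 := by
  refine lp.ext (funext fun e => ?_)
  have hℓ := G.len_pos e
  set g : ℝ → 𝕜 := fun x => f (G.pt e x)
  have hg : Continuous g := h.cont.comp (continuous_pt e)
  have h0 : g =ᵐ[(volume : Measure ℝ).restrict (Icc 0 (G.len e))] fun _ => 0 := by
    filter_upwards [h.eq_ae e, Lp.coeFn_zero 𝕜 2 ((volume : Measure ℝ).restrict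
      (Icc 0 (G.len e)))] with x hx hx'
    exact hx.symm.trans hx'
  have h1 := Measure.eqOn_Icc_of_ae_eq volume hℓ.ne h0 hg.continuousOn continuousOn_const
  refine Lp.ext ?_
  have h2 : ∀ᵐ x ∂((volume : Measure ℝ).restrict (Icc 0 (G.len e))), x ∈ Ioo 0 (G.len e) := by
    rw [← restrict_Ioo_eq_restrict_Icc]
    exact ae_restrict_mem measurableSet_Ioo
  filter_upwards [h.deriv_ae e, h2, Lp.coeFn_zero 𝕜 2 ((volume : Measure ℝ).restrict
      (Icc 0 (G.len e)))] with x hx hxI hx'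
  have h3 : HasDerivAt g 0 x := (hasDerivAt_const x (0 : 𝕜)).congr_of_eventuallyEq (by
    filter_upwards [isOpen_Ioo.mem_nhds hxI] with y hy
    exact h1 (Ioo_subset_Icc_self hy))
  rw [hx.unique h3]
  exact hx'.symm

/-- If the supremum of a function on the graph is bounded by its `H¹`-norm, then the Sobolev
spaces with Dirichlet conditions are closed. -/
theorem isClosed_H1Dirichlet {C : ℝ}
    (hsup : ∀ (f : G.Space → 𝕜) (u v : G.L2 𝕜), IsH1Rep f u v →
      ∀ p, ‖f p‖ ≤ C * ‖WithLp.toLp 2 (u, v)‖) (S : Set G.Vertex) (F : Set (Filter G.Space)) :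
    IsClosed (G.H1Dirichlet 𝕜 S F : Set (WithLp 2 (G.L2 𝕜 × G.L2 𝕜))) := by
  refine IsSeqClosed.isClosed fun w w₀ hw hlim => ?_
  choose f hf hS hF using hw
  have hdiff : ∀ k l p, ‖f k p - f l p‖ ≤ C * ‖w k - w l‖ := fun k l p =>
    hsup _ _ _ ((hf k).sub (hf l)) p
  have hcauchy : ∀ p, CauchySeq fun k => f k p := by
    intro p
    rw [Metric.cauchySeq_iff']
    intro ε hε
    have h1 : Tendsto (fun x : ℕ × ℕ => C * ‖w x.1 - w x.2‖) atTop (𝓝 0) := by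
      have h2 := (cauchySeq_iff_tendsto_dist_atTop_0.1 hlim.cauchySeq).const_mul C
      simpa [dist_eq_norm] using h2
    obtain ⟨⟨N, N'⟩, hN⟩ := eventually_atTop.1 (h1.eventually (gt_mem_nhds hε))
    refine ⟨max N N', fun n hn => ?_⟩
    rw [dist_eq_norm]
    exact (hdiff _ _ p).trans_lt (hN (n, max N N')
      ⟨(le_max_left _ _).trans hn, le_max_right _ _⟩)
  choose g hg using fun p => cauchySeq_tendsto_of_complete (hcauchy p)
  have hunif : ∀ k p, ‖f k p - g p‖ ≤ C * ‖w k - w₀‖ := fun k p =>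
    le_of_tendsto_of_tendsto' (tendsto_const_nhds.sub (hg p)).norm
      ((tendsto_const_nhds.sub hlim).norm.const_mul C) fun l => hdiff k l p
  have hzero : Tendsto (fun k => C * ‖w k - w₀‖) atTop (𝓝 0) := by
    simpa using (tendsto_iff_norm_sub_tendsto_zero.1 hlim).const_mul C
  -- The sup bound makes convergence in norm uniform, so continuity, zeros at vertices and limits at
  -- the ends all survive.
  have hTU : TendstoUniformly f g atTop := by
    rw [Metric.tendstoUniformly_iff]
    intro ε hε
    filter_upwards [hzero.eventually (gt_mem_nhds hε)] with k hk p
    rw [dist_comm, dist_eq_norm]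
    exact (hunif k p).trans_lt hk
  have hgc : Continuous g := hTU.continuous (Frequently.of_forall fun k => (hf k).cont)
  have hfst : Tendsto (fun k => (w k).fst) atTop (𝓝 w₀.fst) :=
    ((WithLp.fstL 2 𝕜 (G.L2 𝕜) (G.L2 𝕜)).continuous.tendsto w₀).comp hlim
  have hsnd : Tendsto (fun k => (w k).snd) atTop (𝓝 w₀.snd) :=
    ((WithLp.sndL 2 𝕜 (G.L2 𝕜) (G.L2 𝕜)).continuous.tendsto w₀).comp hlim
  have hcoord : ∀ {z : ℕ → G.L2 𝕜} {z₀ : G.L2 𝕜}, Tendsto z atTop (𝓝 z₀) → ∀ e,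
      Tendsto (fun k => z k e) atTop (𝓝 (z₀ e)) := by
    intro z z₀ hz e
    rw [tendsto_iff_norm_sub_tendsto_zero] at hz ⊢
    exact squeeze_zero (fun _ => norm_nonneg _)
      (fun k => lp.norm_apply_le_norm two_ne_zero (z k - z₀) e) hz
  have hedge : ∀ e, IsEdgeRep (G.len e) (fun x => g (G.pt e x)) (w₀.fst e) (w₀.snd e) := by
    intro e
    have hℓ := G.len_pos e
    refine IsEdgeRep.of_integral hℓ ?_ fun x hx => ?_
    · have hge : Continuous fun x => g (G.pt e x) := hgc.comp (continuous_pt e)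
      have hmem : MemLp (fun x => g (G.pt e x)) 2
          ((volume : Measure ℝ).restrict (Icc 0 (G.len e))) := by
        obtain ⟨B, hB⟩ := isCompact_Icc.exists_bound_of_continuousOn
          (hge.continuousOn (s := Icc 0 (G.len e)))
        exact MemLp.of_bound hge.aestronglyMeasurable B
          ((ae_restrict_iff' measurableSet_Icc).2 (Eventually.of_forall hB))
      have h1 : Tendsto (fun k => (w k).fst e) atTop (𝓝 (hmem.toLp _)) := by
        rw [tendsto_iff_norm_sub_tendsto_zero]
        refine squeeze_zero (fun _ => norm_nonneg _) (fun k => Lp.norm_le_of_ae_bound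
          (C := C * ‖w k - w₀‖) ((norm_nonneg _).trans (hunif k (G.pt e 0))) ?_)
          (by simpa using hzero.const_mul _)
        filter_upwards [Lp.coeFn_sub ((w k).fst e) (hmem.toLp _), (hf k).eq_ae e,
          hmem.coeFn_toLp] with x h2 h3 h4
        rw [h2, Pi.sub_apply, h3, h4]
        exact hunif k _
      rw [tendsto_nhds_unique (hcoord hfst e) h1]
      exact hmem.coeFn_toLp
    · have h1 : ∀ k, f k (G.pt e x) - f k (G.pt e 0) = ∫ t in (0 : ℝ)..x, (w k).snd e t :=
        fun k => ((hf k).isEdgeRep e).sub_eq_integral hℓ hx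
      refine tendsto_nhds_unique ((hg (G.pt e x)).sub (hg (G.pt e 0))) ?_
      simp only [h1]
      simp only [← fun z : EdgeL2 𝕜 (G.len e) => z.inner_indicator le_rfl hx.1 hx.2]
      exact tendsto_const_nhds.inner (hcoord hsnd e)
  refine ⟨g, ⟨hgc, fun e => (hedge e).ac, fun e => (hedge e).eq_ae,
    fun e => (hedge e).deriv_ae⟩, fun s hs p hp => ?_, fun l hl => ?_⟩
  · have h1 : ∀ k, f k p = 0 := fun k => hS k s hs p hp
    refine tendsto_nhds_unique (hg p) ?_
    simp only [h1]
    exact tendsto_const_nhds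
  · exact hTU.tendsto_of_eventually_tendsto (Eventually.of_forall fun k => hF k l hl)
      tendsto_const_nhds

section Construction

theorem memLp_of_continuous {ℓ : ℝ} {φ : ℝ → 𝕜} (hφ : Continuous φ) :
    MemLp φ 2 ((volume : Measure ℝ).restrict (Icc 0 ℓ)) := by
  obtain ⟨B, hB⟩ := isCompact_Icc.exists_bound_of_continuousOn (hφ.continuousOn (s := Icc 0 ℓ))
  exact MemLp.of_bound hφ.aestronglyMeasurable B
    ((ae_restrict_iff' measurableSet_Icc).2 (Eventually.of_forall hB))

theorem memLp_deriv_of_lipschitzWith {ℓ : ℝ} {φ : ℝ → 𝕜} {K : NNReal} (hφ : LipschitzWith K φ) :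
    MemLp (deriv φ) 2 ((volume : Measure ℝ).restrict (Icc 0 ℓ)) :=
  MemLp.of_bound (stronglyMeasurable_deriv φ).aestronglyMeasurable K
    (Eventually.of_forall fun _ => norm_deriv_le_of_lipschitz hφ)

theorem memLp_eq_zero_of_norm_eq_zero {s : Set G.Edge} (hs : s.Finite)
    {z : ∀ e : G.Edge, EdgeL2 𝕜 (G.len e)} (hz : ∀ e ∉ s, z e = 0) : Memℓp z 2 := by
  refine memℓp_gen (summable_of_hasFiniteSupport (hs.subset fun e he => ?_))
  by_contra h
  simp [hz e h] at he

/-- Lipschitz functions on finitely many edges that agree at the vertices define an element of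
`H¹`. -/
theorem exists_isH1Rep_of_lipschitzWith (φ : G.Edge → ℝ → 𝕜) (val : G.Vertex → 𝕜) {K : NNReal}
    (hφ : ∀ e, LipschitzWith K (φ e)) (h0 : ∀ e, φ e 0 = val (G.vtx e false))
    (h1 : ∀ e, φ e (G.len e) = val (G.vtx e true)) {s : Set G.Edge} (hs : s.Finite)
    (hφs : ∀ e ∉ s, ∀ x, φ e x = 0) :
    ∃ (f : G.Space → 𝕜) (u v : G.L2 𝕜), IsH1Rep f u v ∧
      (∀ e, ∀ x ∈ Icc 0 (G.len e), f (G.pt e x) = φ e x) ∧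
      (∀ w p, G.IsVertexPt w p → f p = val w) ∧
      (∀ e, u e = (memLp_of_continuous (hφ e).continuous).toLp) ∧
      ∀ e, v e = (memLp_deriv_of_lipschitzWith (hφ e)).toLp := by
  have hend : ∀ e b, φ (G.endpt e b).1 (G.endpt e b).2 = val (G.vtx e b) := by
    rintro e (_ | _)
    · exact h0 e
    · exact h1 e
  set f : G.Space → 𝕜 := Quot.lift (fun p : G.Edges => φ p.1 p.2) (by
    rintro _ _ ⟨e, b, e', b', rfl, rfl, h⟩
    simp only [hend, h])
  have hf : ∀ e, ∀ x ∈ Icc 0 (G.len e), f (G.pt e x) = φ e x := by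
    intro e x hx
    have := pt_of_mem e ⟨x, hx⟩
    dsimp only at this
    rw [this]
  set u : G.L2 𝕜 := ⟨fun e => (memLp_of_continuous (hφ e).continuous).toLp,
    memLp_eq_zero_of_norm_eq_zero hs fun e he => by
      have : φ e = 0 := funext (hφs e he)
      simp only [this]
      exact MemLp.toLp_zero _⟩
  set v : G.L2 𝕜 := ⟨fun e => (memLp_deriv_of_lipschitzWith (hφ e)).toLp,
    memLp_eq_zero_of_norm_eq_zero hs fun e he => by
      have : deriv (φ e) = 0 := by
        rw [show φ e = fun _ => 0 from funext (hφs e he), deriv_const']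
        rfl
      simp only [this]
      exact MemLp.toLp_zero _⟩
  refine ⟨f, u, v, ⟨?_, fun e => ?_, fun e => ?_, fun e => ?_⟩, hf, ?_, fun e => rfl, fun e => rfl⟩
  · refine continuous_quot_lift _ (continuous_sigma fun e => ?_)
    exact (hφ e).continuous.comp continuous_subtype_val
  · refine ((hφ e).lipschitzOnWith (s := uIcc 0 (G.len e))).absolutelyContinuousOnInterval.of_dist_le ?_
    rw [uIcc_of_le (G.len_pos e).le]
    intro x hx y hy
    rw [hf e x hx, hf e y hy]
  · filter_upwards [(memLp_of_continuous (ℓ := G.len e) (hφ e).continuous).coeFn_toLp,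
      ae_restrict_mem measurableSet_Icc] with x hx hxI
    rw [hf e x hxI]
    exact hx
  · have h2 : ∀ᵐ x ∂((volume : Measure ℝ).restrict (Icc 0 (G.len e))), x ∈ Ioo 0 (G.len e) := by
      rw [← restrict_Ioo_eq_restrict_Icc]
      exact ae_restrict_mem measurableSet_Ioo
    filter_upwards [(memLp_deriv_of_lipschitzWith (ℓ := G.len e) (hφ e)).coeFn_toLp, h2,
      ae_restrict_of_ae (hφ e).ae_differentiableAt_real] with x hx hxI hd
    have h3 : (v e : ℝ → 𝕜) x = deriv (φ e) x := hx
    rw [h3]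
    refine hd.hasDerivAt.congr_of_eventuallyEq ?_
    filter_upwards [isOpen_Ioo.mem_nhds hxI] with y hy
    exact hf e y (Ioo_subset_Icc_self hy)
  · rintro w _ ⟨e, b, rfl, rfl⟩
    exact hend e b

/-- The Sobolev spaces are dense in `L²` if the functions supported in a single edge satisfy the
conditions at the ends. -/
theorem eq_zero_of_forall_inner_eq_zero {S : Set G.Vertex} {F : Set (Filter G.Space)}
    (hF : ∀ l ∈ F, ∀ e : G.Edge, ∀ᶠ p in l, ∃ e' ≠ e, ∃ x, p = G.pt e' x) {w : G.L2 𝕜}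
    (hw : ∀ g ∈ G.H1Dirichlet 𝕜 S F, inner 𝕜 g.fst w = 0) : w = 0 := by
  classical
  refine lp.ext (funext fun e => ?_)
  have hℓ := G.len_pos e
  -- A test function on the edge `e`, extended by 0, satisfies all boundary conditions; the
  -- fundamental lemma of the calculus of variations then gives `w e = 0`.
  have key : ∀ ψ : ℝ → ℝ, ContDiff ℝ ((⊤ : ℕ∞) : WithTop ℕ∞) ψ → HasCompactSupport ψ → tsupport ψ ⊆ Ioo 0 (G.len e) →
      ∫ x, ψ x • w e x ∂((volume : Measure ℝ).restrict (Icc 0 (G.len e))) = 0 := by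
    intro ψ hψ hψc hψs
    obtain ⟨K, hK⟩ := hψ.lipschitzWith_of_hasCompactSupport hψc (by simp)
    have hψ0 : ψ 0 = 0 := image_eq_zero_of_notMem_tsupport fun h => lt_irrefl _ (hψs h).1
    have hψℓ : ψ (G.len e) = 0 := image_eq_zero_of_notMem_tsupport fun h => lt_irrefl _ (hψs h).2
    set φ : G.Edge → ℝ → 𝕜 := fun e' x => if e' = e then (ψ x : 𝕜) else 0
    have hφ : ∀ e', LipschitzWith K (φ e') := by
      intro e'
      by_cases h : e' = e
      · simp only [φ, h, if_true]
        refine LipschitzWith.of_dist_le_mul fun x y => ?_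
        rw [dist_eq_norm, ← RCLike.ofReal_sub, RCLike.norm_ofReal]
        exact hK.dist_le_mul x y
      · simp only [φ, h, if_false]
        exact (LipschitzWith.const (0 : 𝕜)).weaken zero_le
    have hφe : ∀ e' ≠ e, ∀ x, φ e' x = 0 := fun e' he' x => if_neg he'
    obtain ⟨f, u, v, hf, hfφ, hfv, hu, -⟩ := exists_isH1Rep_of_lipschitzWith φ (fun _ => 0) hφ
      (fun e' => by by_cases h : e' = e <;> simp [φ, h, hψ0])
      (fun e' => by by_cases h : e' = e <;> simp [φ, h, hψℓ])
      (finite_singleton e) hφe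
    have hmem : WithLp.toLp 2 (u, v) ∈ G.H1Dirichlet 𝕜 S F := by
      refine ⟨f, hf, fun s _ p hp => hfv s p hp, fun l hl => ?_⟩
      refine tendsto_const_nhds.congr' ?_
      filter_upwards [hF l hl e] with p hp
      obtain ⟨e', he', x, rfl⟩ := hp
      -- `hF` allows any real coordinate `x`, which `pt` clamps to the edge.
      have h1 : G.pt e' x = G.pt e' (projIcc 0 (G.len e') (G.len_pos e').le x) := by
        rw [pt_of_mem, pt]
      rw [h1, hfφ e' _ (Subtype.coe_prop _), hφe e' he']
    have h2 := hw _ hmem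
    have h3 : inner 𝕜 u w = inner 𝕜 (u e) (w e) := by
      rw [lp.inner_eq_tsum]
      refine tsum_eq_single e fun e' he' => ?_
      have h4 : u e' = 0 := by
        rw [hu]
        have : φ e' = 0 := funext (hφe e' he')
        simp only [this]
        exact MemLp.toLp_zero _
      rw [h4, inner_zero_left]
    have h5 : inner 𝕜 (u e) (w e) = 0 := by rw [← h3]; exact h2
    rw [L2.inner_def] at h5
    rw [← h5]
    refine integral_congr_ae ?_
    have h6 : u e =ᵐ[(volume : Measure ℝ).restrict (Icc 0 (G.len e))] φ e := by
      rw [hu]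
      exact MemLp.coeFn_toLp _
    filter_upwards [h6] with x hx
    rw [hx]
    simp [φ, RCLike.inner_apply, RCLike.real_smul_eq_coe_mul, mul_comm]
  have hint : IntegrableOn (w e) (Icc 0 (G.len e)) := (Lp.memLp (w e)).integrable one_le_two
  have h1 := isOpen_Ioo.ae_eq_zero_of_integral_contDiff_smul_eq_zero (f := (w e : ℝ → 𝕜))
    (μ := volume) (hint.mono_set Ioo_subset_Icc_self).locallyIntegrableOn fun ψ h h' h'' => by
      rw [← key ψ h h' h'']
      refine (setIntegral_eq_integral_of_forall_compl_eq_zero fun x hx => ?_).symm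
      have : ψ x = 0 := image_eq_zero_of_notMem_tsupport
        fun h => hx (Ioo_subset_Icc_self (h'' h))
      rw [this, zero_smul]
  refine Lp.ext ?_
  have h2 : ∀ᵐ x ∂((volume : Measure ℝ).restrict (Icc 0 (G.len e))), x ∈ Ioo 0 (G.len e) := by
    rw [← restrict_Ioo_eq_restrict_Icc]
    exact ae_restrict_mem measurableSet_Ioo
  filter_upwards [ae_restrict_of_ae h1, h2, Lp.coeFn_zero 𝕜 2 ((volume : Measure ℝ).restrict
      (Icc 0 (G.len e)))] with x hx hxI hx'
  rw [hx hxI]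
  exact hx'.symm

end Construction

end MetricGraph

/-! ### A criterion for compact embedding. -/

namespace MetricGraph

variable {G : MetricGraph} {𝕜 : Type*} [RCLike 𝕜]

/-- A criterion for the compactness of the embedding of a Sobolev space into `L²`. -/
theorem isCompactOperator_formEmbedding (S : Set G.Vertex) (F : Set (Filter G.Space))
    [CompleteSpace (G.H1Dirichlet 𝕜 S F)] {c d : G.Edge → ℝ} (hc : Summable c)
    (hd : Tendsto d cofinite (𝓝 0))
    (hle : ∀ w ∈ G.H1Dirichlet 𝕜 S F, ∀ e,
      ‖w.fst e‖ ^ 2 ≤ c e * ‖w‖ ^ 2 + d e * ‖w.snd e‖ ^ 2) :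
    IsCompactOperator (formEmbedding (G.H1Dirichlet 𝕜 S F)) := by
  classical
  refine isCompactOperator_of_small_on_orthogonal (𝕜 := 𝕜) _ fun ε hε => ?_
  -- One half of `ε²` pays for the derivative terms, the other for the tail of `c`. Off the finite
  -- set `s` of edges `hle` is used, on `s` Rellich's theorem.
  set η := ε ^ 2 / 2
  have hη : 0 < η := by positivity
  obtain ⟨s, hs1, hs2⟩ : ∃ s : Finset G.Edge, ∑' e : {e // e ∉ s}, c e < η ∧
      ∀ e ∉ s, d e < η := by
    have h1 := (tendsto_tsum_compl_atTop_zero c).eventually (gt_mem_nhds hη)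
    have h2 : {e | ¬ d e < η}.Finite := hd.eventually (gt_mem_nhds hη)
    obtain ⟨s, hs, hs'⟩ := (h1.and (eventually_ge_atTop h2.toFinset)).exists
    refine ⟨s, hs, fun e he => ?_⟩
    by_contra hlt
    exact he (hs' (h2.mem_toFinset.2 hlt))
  choose t ht htle using fun e => exists_finite_norm_sq_le_of_inner_eq_zero (𝕜 := 𝕜)
    (G.len_pos e) hη
  set ι := formEmbedding (G.H1Dirichlet 𝕜 S F)
  -- Rellich's orthogonality conditions on the edges of `s` are pulled back by `ι*` to conditions in
  -- the form domain.
  refine ⟨⋃ e ∈ s, (fun a => ι.adjoint (lp.single 2 e a)) '' t e,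
    s.finite_toSet.biUnion fun e _ => (ht e).image _, fun x hx => ?_⟩
  obtain ⟨w, hw⟩ := x
  set T : Set G.Edge := {e | e ∉ s}
  have hedge : ∀ e, ‖w.fst e‖ ^ 2 ≤ η * ‖w.snd e‖ ^ 2 + T.indicator c e * ‖w‖ ^ 2 := by
    intro e
    by_cases he : e ∈ s
    · obtain ⟨f, hf, -⟩ := id hw
      have h1 := htle e _ _ _ (hf.isEdgeRep e) fun a ha => by
        have h2 := hx _ (mem_biUnion he (mem_image_of_mem _ ha))
        rw [ContinuousLinearMap.adjoint_inner_left, lp.inner_single_left] at h2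
        exact h2
      rw [indicator_of_notMem (by simpa [T] using he), zero_mul, add_zero]
      exact h1
    · rw [indicator_of_mem (show e ∈ T from he)]
      have h1 := hle w hw e
      have h2 : d e * ‖w.snd e‖ ^ 2 ≤ η * ‖w.snd e‖ ^ 2 := by
        gcongr
        exact (hs2 e he).le
      linarith
  have hsum : HasSum (T.indicator c) (∑' e : {e // e ∉ s}, c e) :=
    hasSum_subtype_iff_indicator.1 (hc.subtype T).hasSum
  have h1 := hasSum_le hedge (hasSum_norm_sq w.fst)
    (((hasSum_norm_sq w.snd).mul_left η).add (hsum.mul_right (‖w‖ ^ 2)))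
  have h2 := WithLp.prod_norm_sq_eq_of_L2 w
  have h3 : ‖w.fst‖ ^ 2 ≤ (ε * ‖w‖) ^ 2 := by
    have h4 : (∑' e : {e // e ∉ s}, c e) * ‖w‖ ^ 2 ≤ η * ‖w‖ ^ 2 := by gcongr
    have h5 : η * ‖w.snd‖ ^ 2 ≤ η * ‖w‖ ^ 2 :=
      mul_le_mul_of_nonneg_left (by linarith [sq_nonneg ‖w.fst‖]) hη.le
    rw [mul_pow]
    linarith [show ε ^ 2 * ‖w‖ ^ 2 = η * ‖w‖ ^ 2 + η * ‖w‖ ^ 2 by simp only [η]; ring]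
  exact le_of_sq_le_sq h3 (by positivity)

theorem quot_endpt_eq {e e' : G.Edge} {b b' : Bool} (h : G.vtx e b = G.vtx e' b') :
    (Quot.mk G.Glue (G.endpt e b)) = Quot.mk G.Glue (G.endpt e' b') :=
  Quot.sound ⟨e, b, e', b', rfl, rfl, h⟩

theorem pt_zero (e : G.Edge) : G.pt e 0 = Quot.mk G.Glue (G.endpt e false) :=
  pt_of_mem e ⟨0, le_rfl, (G.len_pos e).le⟩

theorem pt_len (e : G.Edge) : G.pt e (G.len e) = Quot.mk G.Glue (G.endpt e true) :=
  pt_of_mem e ⟨G.len e, (G.len_pos e).le, le_rfl⟩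

end MetricGraph

/-! ### Estimates on the comb. -/

namespace DiagonalComb

open MetricGraph

variable {𝕜 : Type*} [RCLike 𝕜] {α : ℝ} {hα : 0 < α}

theorem node_pos (α : ℝ) (n : ℕ) : 0 < node α n := by
  unfold node
  positivity

theorem node_zero (α : ℝ) : node α 0 = 1 := by simp [node]

theorem node_anti (hα : 0 < α) : Antitone (node α) := by
  intro m n h
  unfold node
  apply Real.rpow_le_rpow_of_nonpos (by positivity) _ (by linarith)
  gcongr

theorem node_le_one (hα : 0 < α) (n : ℕ) : node α n ≤ 1 := by
  rw [← node_zero α]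
  exact node_anti hα n.zero_le

theorem tendsto_node (hα : 0 < α) : Tendsto (node α) atTop (𝓝 0) :=
  (tendsto_rpow_neg_atTop hα).comp
    (tendsto_atTop_add_const_right _ 1 tendsto_natCast_atTop_atTop)

theorem summable_node_iff : Summable (node α) ↔ 1 < α := by
  have h1 : node α = fun n : ℕ => (fun k : ℕ => (k : ℝ) ^ (-α)) (n + 1) := by
    funext n
    simp [node]
  rw [h1, summable_nat_add_iff (f := fun k : ℕ => (k : ℝ) ^ (-α)) 1, Real.summable_nat_rpow, neg_lt_neg_iff]

theorem summable_node_sq (h : 1 / 2 < α) : Summable fun n => node α n ^ 2 := by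
  have h1 : (fun n => node α n ^ 2) = node (α * 2) := by
    funext n
    rw [node, node, ← Real.rpow_natCast, ← Real.rpow_mul (by positivity)]
    norm_num
  rw [h1, summable_node_iff]
  linarith

/-- The edges of the comb are the pieces of the shaft and the teeth. -/
def edgeEquiv : ℕ ⊕ ℕ ≃ Edge where
  toFun := Sum.elim Edge.shaft Edge.tooth
  invFun
    | .shaft n => Sum.inl n
    | .tooth n => Sum.inr n
  left_inv := by rintro (n | n) <;> rfl
  right_inv := by rintro (n | n) <;> rfl

theorem summable_edge {c : Edge → ℝ} (h1 : Summable fun n => c (.shaft n))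
    (h2 : Summable fun n => c (.tooth n)) : Summable c :=
  edgeEquiv.summable_iff.1 (Summable.sum _ h1 h2)

theorem tendsto_index : Tendsto Edge.index cofinite atTop := by
  rw [← Nat.cofinite_eq_atTop]
  refine Tendsto.cofinite_of_finite_preimage_singleton fun n => ?_
  refine Set.Finite.subset (s := {Edge.shaft n, Edge.tooth n}) (by simp) ?_
  rintro (m | m) hm <;> simp [Edge.index] at hm <;> simp [hm]

/-- The lengths telescope, with total at most 1. -/
theorem summable_shaft_len (hα : 0 < α) : Summable fun n => len α (.shaft n) := by
  refine summable_of_sum_range_le (c := 1) (fun n => (len_pos hα _).le) fun n => ?_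
  simp only [len]
  rw [Finset.sum_range_sub', node_zero]
  linarith [node_pos α n]

theorem len_le_one (hα : 0 < α) (e : Edge) : len α e ≤ 1 := by
  rcases e with n | n
  · simp only [len]
    linarith [node_le_one hα n, node_pos α (n + 1)]
  · exact node_le_one hα n

/-- The value of a function at the node `(n+1)^(-α)` of the shaft. -/
def jointVal (f : (diagonalComb α hα).Space → 𝕜) (n : ℕ) : 𝕜 :=
  f ((diagonalComb α hα).pt (Edge.tooth n) 0)

omit [RCLike 𝕜] in
theorem shaft_len_eq_jointVal (f : (diagonalComb α hα).Space → 𝕜) (n : ℕ) :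
    f ((diagonalComb α hα).pt (Edge.shaft n) (len α (.shaft n))) = jointVal f n :=
  congrArg f ((pt_len (G := diagonalComb α hα) (Edge.shaft n)).trans
    ((quot_endpt_eq (G := diagonalComb α hα) (e := Edge.shaft n) (b := true) (e' := Edge.tooth n)
      (b' := false) rfl).trans (pt_zero (G := diagonalComb α hα) (Edge.tooth n)).symm))

omit [RCLike 𝕜] in
theorem shaft_zero_eq_jointVal (f : (diagonalComb α hα).Space → 𝕜) (n : ℕ) :
    f ((diagonalComb α hα).pt (Edge.shaft n) 0) = jointVal f (n + 1) :=
  congrArg f ((pt_zero (G := diagonalComb α hα) (Edge.shaft n)).trans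
    ((quot_endpt_eq (G := diagonalComb α hα) (e := Edge.shaft n) (b := false)
      (e' := Edge.tooth (n + 1)) (b' := false) rfl).trans
        (pt_zero (G := diagonalComb α hα) (Edge.tooth (n + 1))).symm))

section Bounds

variable {f : (diagonalComb α hα).Space → 𝕜} {u v : (diagonalComb α hα).L2 𝕜}
  (h : IsH1Rep f u v)

include h

theorem norm_jointVal_sub_succ_sq_le (n : ℕ) :
    ‖jointVal f n - jointVal f (n + 1)‖ ^ 2 ≤ len α (.shaft n) * ‖v (Edge.shaft n)‖ ^ 2 := by
  have hℓ := len_pos hα (.shaft n)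
  have h1 := (h.isEdgeRep (Edge.shaft n)).norm_sub_sq_le_length hℓ (left_mem_Icc.2 hℓ.le)
    (right_mem_Icc.2 hℓ.le)
  rw [← shaft_len_eq_jointVal, ← shaft_zero_eq_jointVal]
  exact h1

omit h in
theorem sum_norm_shaft_sq_le (v : (diagonalComb α hα).L2 𝕜) (s : Finset ℕ) :
    ∑ k ∈ s, ‖v (Edge.shaft k)‖ ^ 2 ≤ ‖v‖ ^ 2 := by
  let i : ℕ ↪ (diagonalComb α hα).Edge := ⟨Edge.shaft, fun a b hab => Edge.shaft.inj hab⟩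
  have h1 := sum_le_hasSum (s.map i) (fun e _ => sq_nonneg ‖v e‖) (hasSum_norm_sq v)
  rwa [Finset.sum_map] at h1

/-- The Hölder bound along the shaft: Cauchy–Schwarz over its pieces, whose lengths telescope. -/
theorem norm_jointVal_sub_le {m n : ℕ} (hmn : m ≤ n) :
    ‖jointVal f m - jointVal f n‖ ≤ √(node α m - node α n) * ‖v‖ := by
  have h1 := dist_le_Ico_sum_dist (jointVal f) hmn
  rw [dist_eq_norm] at h1
  have h2 : ∑ k ∈ Finset.Ico m n, dist (jointVal f k) (jointVal f (k + 1)) ≤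
      ∑ k ∈ Finset.Ico m n, √(len α (.shaft k)) * ‖v (Edge.shaft k)‖ := by
    refine Finset.sum_le_sum fun k _ => ?_
    rw [dist_eq_norm]
    refine le_of_sq_le_sq ?_ (by positivity)
    rw [mul_pow, Real.sq_sqrt (len_pos hα _).le]
    exact norm_jointVal_sub_succ_sq_le h k
  have h3 := Finset.sum_mul_sq_le_sq_mul_sq (Finset.Ico m n) (fun k => √(len α (.shaft k)))
    (fun k => ‖v (Edge.shaft k)‖)
  have h4 : ∑ k ∈ Finset.Ico m n, √(len α (.shaft k)) ^ 2 = node α m - node α n := by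
    rw [Finset.sum_congr rfl fun k _ => Real.sq_sqrt (len_pos hα (.shaft k)).le]
    simp only [len]
    rw [Finset.sum_Ico_eq_sub _ hmn, Finset.sum_range_sub', Finset.sum_range_sub']
    ring
  rw [h4] at h3
  have h5 : 0 ≤ node α m - node α n := sub_nonneg.2 (node_anti hα hmn)
  refine (h1.trans h2).trans (le_of_sq_le_sq (h3.trans ?_) (by positivity))
  rw [mul_pow, Real.sq_sqrt h5]
  gcongr
  exact sum_norm_shaft_sq_le v _

/-- The tooth at `joint 0` has length 1, so it controls the value there by the norm; the rest of the
shaft is within distance 1. Squaring `‖jointVal f 0‖ + ‖v‖` gives at most `4 ‖u‖² + 6 ‖v‖²`. -/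
theorem norm_jointVal_sq_le (n : ℕ) :
    ‖jointVal f n‖ ^ 2 ≤ 6 * ‖WithLp.toLp 2 (u, v)‖ ^ 2 := by
  have hW : ‖WithLp.toLp 2 (u, v)‖ ^ 2 = ‖u‖ ^ 2 + ‖v‖ ^ 2 := WithLp.prod_norm_sq_eq_of_L2 _
  have h0 : ‖jointVal f 0‖ ^ 2 ≤ 2 * ‖u‖ ^ 2 + 2 * ‖v‖ ^ 2 := by
    have hℓ := len_pos hα (.tooth 0)
    have h1 : node α 0 * ‖jointVal f 0‖ ^ 2 ≤ 2 * ‖u (Edge.tooth 0)‖ ^ 2 +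
        2 * (node α 0 ^ 2 * ‖v (Edge.tooth 0)‖ ^ 2) :=
      (h.isEdgeRep (Edge.tooth 0)).length_mul_norm_sq_le hℓ (left_mem_Icc.2 hℓ.le)
    have h3 := lp.norm_apply_le_norm two_ne_zero u (Edge.tooth 0)
    have h4 := lp.norm_apply_le_norm two_ne_zero v (Edge.tooth 0)
    have h5 := pow_le_pow_left₀ (norm_nonneg _) h3 2
    have h6 := pow_le_pow_left₀ (norm_nonneg _) h4 2
    rw [node_zero, one_mul, one_pow, one_mul] at h1
    exact h1.trans (by gcongr)
  have h1 : ‖jointVal f 0 - jointVal f n‖ ≤ ‖v‖ := by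
    refine (norm_jointVal_sub_le h n.zero_le).trans (mul_le_of_le_one_left (norm_nonneg _) ?_)
    refine Real.sqrt_le_one.2 ?_
    rw [node_zero]
    linarith [node_pos α n]
  have h2 : ‖jointVal f n‖ ≤ ‖jointVal f 0‖ + ‖v‖ := by
    have := norm_sub_le (jointVal f 0) (jointVal f 0 - jointVal f n)
    rw [sub_sub_cancel] at this
    linarith
  have h3 : ‖jointVal f n‖ ^ 2 ≤ (‖jointVal f 0‖ + ‖v‖) ^ 2 :=
    pow_le_pow_left₀ (norm_nonneg _) h2 2
  nlinarith [sq_nonneg (‖jointVal f 0‖ - ‖v‖), sq_nonneg ‖u‖]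

/-- Every edge has length at most 1 and contains a joint, so the squared constant is `2 * 6 + 2 ≤
16`. This is the sup bound behind closedness. -/
theorem norm_apply_le (p : (diagonalComb α hα).Space) :
    ‖f p‖ ≤ 4 * ‖WithLp.toLp 2 (u, v)‖ := by
  have hW : ‖WithLp.toLp 2 (u, v)‖ ^ 2 = ‖u‖ ^ 2 + ‖v‖ ^ 2 := WithLp.prod_norm_sq_eq_of_L2 _
  obtain ⟨e, x, hx, rfl⟩ := exists_eq_pt p
  have hℓ := len_pos hα e
  obtain ⟨n, y, hy, hn⟩ : ∃ n, ∃ y ∈ Icc 0 (len α e), f ((diagonalComb α hα).pt e y) =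
      jointVal f n := by
    rcases e with n | n
    · exact ⟨n, _, right_mem_Icc.2 hℓ.le, shaft_len_eq_jointVal f n⟩
    · exact ⟨n, 0, left_mem_Icc.2 hℓ.le, rfl⟩
  have h1 := (h.isEdgeRep e).norm_sq_le_add hℓ hy hx
  dsimp only at h1
  rw [hn] at h1
  have h2 := norm_jointVal_sq_le h n
  have h3 : len α e * ‖v e‖ ^ 2 ≤ 1 * ‖v‖ ^ 2 := by
    gcongr
    · exact len_le_one hα e
    · exact lp.norm_apply_le_norm two_ne_zero v e
  have h4 : (diagonalComb α hα).len e * ‖v e‖ ^ 2 ≤ 1 * ‖v‖ ^ 2 := h3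
  refine le_of_sq_le_sq ?_ (by positivity)
  rw [mul_pow]
  linarith [sq_nonneg ‖u‖, sq_nonneg ‖v‖]

theorem norm_shaft_sq_le (n : ℕ) :
    ‖u (Edge.shaft n)‖ ^ 2 ≤ 16 * len α (.shaft n) * ‖WithLp.toLp 2 (u, v)‖ ^ 2 := by
  have hℓ := len_pos hα (.shaft n)
  have h1 := (h.isEdgeRep (Edge.shaft n)).norm_sq_le_of_le hℓ
    (C := (4 * ‖WithLp.toLp 2 (u, v)‖) ^ 2) fun x _ =>
      pow_le_pow_left₀ (norm_nonneg _) (norm_apply_le h _) 2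
  refine h1.trans_eq ?_
  change len α (.shaft n) * _ = _
  ring

/-- The point `x` is left free: the joint serves the Neumann case, the tip the Dirichlet case. -/
theorem norm_tooth_sq_le (n : ℕ) {x : ℝ} (hx : x ∈ Icc 0 (node α n)) :
    ‖u (Edge.tooth n)‖ ^ 2 ≤
      2 * (node α n * ‖f ((diagonalComb α hα).pt (Edge.tooth n) x)‖ ^ 2)
        + 2 * node α n ^ 2 * ‖v (Edge.tooth n)‖ ^ 2 := by
  have h1 := (h.isEdgeRep (Edge.tooth n)).norm_sq_le (node_pos α n) hx
  rw [mul_assoc 2 (node α n ^ 2)]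
  exact h1

/-- If the teeth have infinite total length, a function in `H¹` tends to `0` along the shaft. -/
theorem norm_jointVal_le_of_le_one (hα1 : α ≤ 1) (n : ℕ) :
    ‖jointVal f n‖ ≤ √(node α n) * ‖v‖ := by
  have hs : Summable fun m => node α m * ‖jointVal f m‖ ^ 2 := by
    have hu : Summable fun m => ‖u (Edge.tooth m)‖ ^ 2 :=
      (hasSum_norm_sq u).summable.comp_injective (i := Edge.tooth) fun a b hab => by
        simpa using hab
    have hv : Summable fun m => ‖v (Edge.tooth m)‖ ^ 2 :=
      (hasSum_norm_sq v).summable.comp_injective (i := Edge.tooth) fun a b hab => by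
        simpa using hab
    refine Summable.of_nonneg_of_le (fun m => mul_nonneg (node_pos α m).le (sq_nonneg _))
      (fun m => ?_) ((hu.mul_left 2).add (hv.mul_left 2))
    have h1 := (h.isEdgeRep (Edge.tooth m)).length_mul_norm_sq_le (node_pos α m)
      (left_mem_Icc.2 (node_pos α m).le)
    have h2 : node α m ^ 2 * ‖v (Edge.tooth m)‖ ^ 2 ≤ 1 * ‖v (Edge.tooth m)‖ ^ 2 := by
      gcongr
      exact pow_le_one₀ (node_pos α m).le (node_le_one hα m)
    rw [one_mul] at h2
    exact h1.trans (add_le_add le_rfl (mul_le_mul_of_nonneg_left h2 two_pos.le))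
  have hnot : ¬ Summable (node α) := by
    rw [summable_node_iff]
    exact not_lt.2 hα1
  refine le_of_forall_pos_le_add fun η hη => ?_
  -- The weighted sum of `‖jointVal f m‖²` converges while the weights `node α m` do not, so small
  -- values occur arbitrarily far out; comparing `n` with such an `m` gives the bound.
  have hfreq : ∃ m ≥ n, ‖jointVal f m‖ < η := by
    by_contra! hall
    refine hnot ((summable_nat_add_iff n).1 ?_)
    refine Summable.of_nonneg_of_le (fun m => (node_pos α _).le) (fun m => ?_)
      (((summable_nat_add_iff n).2 hs).mul_left (η ^ 2)⁻¹)
    have h1 := pow_le_pow_left₀ hη.le (hall (m + n) (Nat.le_add_left n m)) 2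
    rw [← div_eq_inv_mul, le_div_iff₀ (by positivity)]
    have := node_pos α (m + n)
    gcongr
  obtain ⟨m, hm, hlt⟩ := hfreq
  have h1 := norm_jointVal_sub_le h hm
  have h2 : √(node α n - node α m) * ‖v‖ ≤ √(node α n) * ‖v‖ := by
    gcongr
    linarith [node_pos α m]
  have h3 := norm_add_le (jointVal f n - jointVal f m) (jointVal f m)
  rw [sub_add_cancel] at h3
  linarith

/-- For `α > 1/2` the values at the nodes are square summable with the lengths as weights. -/
theorem node_mul_norm_jointVal_sq_le (n : ℕ) :
    node α n * ‖jointVal f n‖ ^ 2 ≤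
      (if α ≤ 1 then node α n ^ 2 else 6 * node α n) * ‖WithLp.toLp 2 (u, v)‖ ^ 2 := by
  have hn := node_pos α n
  -- For `α ≤ 1` decay along the shaft yields the weight `node²`, summable if `α > 1/2`. For `α > 1`
  -- the nodes themselves are summable and the sup bound is enough.
  split_ifs with hα1
  · have hW : ‖WithLp.toLp 2 (u, v)‖ ^ 2 = ‖u‖ ^ 2 + ‖v‖ ^ 2 := WithLp.prod_norm_sq_eq_of_L2 _
    have h1 := pow_le_pow_left₀ (norm_nonneg _) (norm_jointVal_le_of_le_one h hα1 n) 2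
    rw [mul_pow, Real.sq_sqrt hn.le] at h1
    calc node α n * ‖jointVal f n‖ ^ 2 ≤ node α n * (node α n * ‖v‖ ^ 2) := by gcongr
      _ = node α n ^ 2 * ‖v‖ ^ 2 := by ring
      _ ≤ _ := mul_le_mul_of_nonneg_left (by linarith [sq_nonneg ‖u‖]) (sq_nonneg _)
  · calc node α n * ‖jointVal f n‖ ^ 2 ≤ node α n * (6 * ‖WithLp.toLp 2 (u, v)‖ ^ 2) := by
          gcongr
          exact norm_jointVal_sq_le h n
      _ = _ := by ring

end Bounds

/-! ### Self-adjointness and compact embeddings on the comb. -/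

instance completeSpace_H1Dirichlet (S : Set (diagonalComb α hα).Vertex)
    (F : Set (Filter (diagonalComb α hα).Space)) :
    CompleteSpace ((diagonalComb α hα).H1Dirichlet 𝕜 S F) :=
  (isClosed_H1Dirichlet (C := 4) (fun _ _ _ h p => norm_apply_le h p) S F).completeSpace_coe

theorem eventually_endZero (e : (diagonalComb α hα).Edge) :
    ∀ᶠ p in endZero α hα, ∃ e' ≠ e, ∃ x, p = (diagonalComb α hα).pt e' x := by
  have h1 : {p | ∃ e' : Edge, Edge.index e + 1 ≤ e'.index ∧ ∃ x : ℝ,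
      p = (diagonalComb α hα).pt e' x} ∈ endZero α hα :=
    mem_iInf_of_mem _ (mem_principal_self _)
  filter_upwards [h1] with p hp
  obtain ⟨e', he', hx⟩ := hp
  refine ⟨e', ?_, hx⟩
  rintro rfl
  exact absurd he' (by omega)

/-- Taking `F` empty or `{endZero α hα}` covers the Neumann and the Dirichlet operator at once. -/
theorem isSymmetricInverseAddOne_mixed (S : Set (diagonalComb α hα).Vertex)
    {F : Set (Filter (diagonalComb α hα).Space)} (hF : F ⊆ {endZero α hα}) :
    IsSymmetricInverseAddOne ((diagonalComb α hα).mixedLaplacian 𝕜 S F)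
      (formResolvent ((diagonalComb α hα).H1Dirichlet 𝕜 S F)) := by
  refine isSymmetricInverseAddOne_formResolvent _ ?_ fun w hw =>
    eq_zero_of_forall_inner_eq_zero (S := S) (F := F) (fun l hl e => ?_) hw
  · rintro g ⟨f, hf, -⟩ h0
    rw [h0] at hf
    exact hf.eq_zero_of_eq_zero
  · rw [mem_singleton_iff.1 (hF hl)]
    exact eventually_endZero e

/-- The shaft has summable coefficients by the sup bound, and the derivative coefficients on the
teeth tend to 0; only a value at one point of each tooth is left to control. -/
theorem isCompactOperator_comb (S : Set (diagonalComb α hα).Vertex)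
    (F : Set (Filter (diagonalComb α hα).Space)) {b : ℕ → ℝ} (hb : Summable b)
    (hle : ∀ f, ∀ w ∈ (diagonalComb α hα).H1Dirichlet 𝕜 S F, IsH1Rep f w.fst w.snd →
      (∀ s ∈ S, ∀ p, (diagonalComb α hα).IsVertexPt s p → f p = 0) → ∀ n,
      ∃ x ∈ Icc 0 (node α n), node α n * ‖f ((diagonalComb α hα).pt (Edge.tooth n) x)‖ ^ 2 ≤
        b n * ‖w‖ ^ 2) :
    IsCompactOperator (formEmbedding ((diagonalComb α hα).H1Dirichlet 𝕜 S F)) := by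
  have hd : Tendsto (fun e : Edge => 2 * node α e.index ^ 2) cofinite (𝓝 0) := by
    simpa using (((tendsto_node hα).comp tendsto_index).pow 2).const_mul 2
  refine isCompactOperator_formEmbedding S F
    (c := fun e : Edge => match e with
      | .shaft n => 16 * len α (.shaft n)
      | .tooth n => 2 * b n)
    (summable_edge ((summable_shaft_len hα).mul_left 16) (hb.mul_left 2)) hd ?_
  intro w hw e
  obtain ⟨f, hf, hfS, -⟩ := id hw
  rcases e with n | n
  · have h1 := norm_shaft_sq_le hf n
    have h2 : 0 ≤ 2 * node α n ^ 2 * ‖w.snd (Edge.shaft n)‖ ^ 2 := by positivity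
    exact h1.trans (le_add_of_nonneg_right h2)
  · obtain ⟨x, hx, hfx⟩ := hle f w hw hf hfS n
    have h1 := norm_tooth_sq_le hf n hx
    refine h1.trans (add_le_add ?_ le_rfl)
    change _ ≤ 2 * b n * ‖w‖ ^ 2
    linarith

theorem isCompactOperator_H1 (h : 1 / 2 < α) :
    IsCompactOperator (formEmbedding ((diagonalComb α hα).H1 𝕜)) := by
  refine isCompactOperator_comb ∅ ∅ (b := fun n => if α ≤ 1 then node α n ^ 2 else 6 * node α n)
    ?_ fun f w _ hf _ n => ⟨0, left_mem_Icc.2 (node_pos α n).le,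
      node_mul_norm_jointVal_sq_le hf n⟩
  split_ifs with hα1
  · exact summable_node_sq h
  · exact (summable_node_iff.2 (not_le.1 hα1)).mul_left 6

/-- The function vanishes at the tip, so the remaining term is 0. -/
theorem isCompactOperator_H1Dirichlet :
    IsCompactOperator (formEmbedding (H1Dirichlet 𝕜 α hα)) := by
  refine isCompactOperator_comb (tips α hα) {endZero α hα} (b := 0) summable_zero
    fun f w _ hf hfS n => ⟨node α n, right_mem_Icc.2 (node_pos α n).le, ?_⟩
  have h1 := hfS (Vertex.tip n) (mem_range_self n)
    ((diagonalComb α hα).pt (Edge.tooth n) (node α n)) ⟨Edge.tooth n, true, rfl, pt_len _⟩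
  rw [h1]
  simp

end DiagonalComb

/-! ### Tents along the shaft: failure of compactness for `α ≤ 1/2`. -/

namespace MetricGraph

variable {G : MetricGraph} {𝕜 : Type*} [RCLike 𝕜]

theorem IsH1Rep.inner_eq_zero {f g : G.Space → 𝕜} {u v u' v' : G.L2 𝕜} (hf : IsH1Rep f u v)
    (hg : IsH1Rep g u' v') (hfg : ∀ p, f p = 0 ∨ g p = 0) : inner 𝕜 u u' = 0 := by
  rw [lp.inner_eq_tsum]
  refine (tsum_congr fun e => ?_).trans tsum_zero
  rw [L2.inner_def]
  refine integral_eq_zero_of_ae ?_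
  filter_upwards [hf.eq_ae e, hg.eq_ae e] with x h1 h2
  rw [h1, h2]
  rcases hfg (G.pt e x) with h | h <;> simp [h]

theorem toLp_deriv_eq_zero {ℓ : ℝ} {φ : ℝ → 𝕜} {K : NNReal} (hφ : LipschitzWith K φ) {c : 𝕜}
    (h : φ = fun _ => c) : (memLp_deriv_of_lipschitzWith (ℓ := ℓ) hφ).toLp = 0 := by
  simp only [h, deriv_const']
  exact MemLp.toLp_zero _

theorem norm_toLp_deriv_sq_le {ℓ : ℝ} (hℓ : 0 ≤ ℓ) {φ : ℝ → 𝕜} (hφ : LipschitzWith 1 φ) :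
    ‖(memLp_deriv_of_lipschitzWith (ℓ := ℓ) hφ).toLp‖ ^ 2 ≤ ℓ := by
  rw [EdgeL2.norm_sq_eq_integral]
  have h1 : ∀ᵐ x ∂((volume : Measure ℝ).restrict (Icc 0 ℓ)),
      ‖‖(memLp_deriv_of_lipschitzWith (ℓ := ℓ) hφ).toLp _ x‖ ^ 2‖ ≤ 1 := by
    filter_upwards [(memLp_deriv_of_lipschitzWith (ℓ := ℓ) hφ).coeFn_toLp] with x hx
    rw [hx, norm_pow, norm_norm]
    exact pow_le_one₀ (norm_nonneg _) (norm_deriv_le_of_lipschitz hφ)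
  have h2 := norm_integral_le_of_norm_le_const h1
  rw [one_mul, measureReal_restrict_apply_univ, Real.volume_real_Icc_of_le hℓ, sub_zero] at h2
  exact (Real.le_norm_self _).trans h2

/-- Every point of the graph lies on an edge. -/
theorem forall_of_forall_pt {P : G.Space → Prop} (h : ∀ e, ∀ x ∈ Icc 0 (G.len e), P (G.pt e x))
    (p : G.Space) : P p := by
  obtain ⟨e, x, hx, rfl⟩ := exists_eq_pt p
  exact h e x hx

end MetricGraph

/-- The tent of slope `1` and height `3 s / 4` centred at `s`. -/
def tent (s x : ℝ) : ℝ := max 0 (3 / 4 * s - |x - s|)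

theorem lipschitzWith_tent (s : ℝ) : LipschitzWith 1 (tent s) := by
  have h1 : LipschitzWith 1 fun x : ℝ => x - s :=
    LipschitzWith.of_dist_le_mul fun x y => by simp
  have h2 : LipschitzWith 1 fun x : ℝ => |x - s| := by
    have h3 := lipschitzWith_one_norm.comp h1
    rwa [one_mul] at h3
  have h3 : LipschitzWith 1 fun x : ℝ => 3 / 4 * s - |x - s| := by
    simpa using (LipschitzWith.const (3 / 4 * s)).sub h2
  exact h3.const_max 0

theorem tent_of_le {s x : ℝ} (hx : x ≤ s / 4) : tent s x = 0 :=
  max_eq_left (by linarith [neg_abs_le (x - s)])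

theorem tent_of_ge {s x : ℝ} (hx : 7 / 4 * s ≤ x) : tent s x = 0 :=
  max_eq_left (by linarith [le_abs_self (x - s)])

theorem le_tent_of_le {s x : ℝ} (hx : x ≤ s) : x - s / 4 ≤ tent s x :=
  le_max_of_le_right (by rw [abs_of_nonpos (by linarith)]; linarith)

/-- The tent at `s` lives on `[s/4, 7s/4]`; a factor 7 between the centres separates the supports,
which gives orthogonality. -/
theorem tent_eq_zero_or {s t : ℝ} (h : 7 * t ≤ s) (x : ℝ) : tent s x = 0 ∨ tent t x = 0 := by
  rcases le_total x (s / 4) with h1 | h1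
  · exact Or.inl (tent_of_le h1)
  · exact Or.inr (tent_of_ge (by linarith))

namespace DiagonalComb

open MetricGraph

variable {𝕜 : Type*} [RCLike 𝕜] {α : ℝ} {hα : 0 < α}

/-- The position along the shaft of a point of the comb. -/
def shaftPos (α : ℝ) : Edge → ℝ → ℝ
  | .shaft n, x => max (node α (n + 1)) (min (node α n) (node α (n + 1) + x))
  | .tooth n, _ => node α n

theorem lipschitzWith_shaftPos (e : Edge) : LipschitzWith 1 (shaftPos α e) := by
  rcases e with n | n
  · have h : LipschitzWith 1 fun x : ℝ => node α (n + 1) + x :=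
      LipschitzWith.of_dist_le_mul fun x y => by simp
    exact (h.const_min (node α n)).const_max (node α (n + 1))
  · exact (LipschitzWith.const _).weaken zero_le_one

variable (𝕜 α) in
/-- The function on the edges of the comb given by the tent at `s` and the position along the
shaft. -/
def tentEdge (s : ℝ) (e : Edge) (x : ℝ) : 𝕜 := (tent s (shaftPos α e x) : 𝕜)

theorem lipschitzWith_tentEdge (s : ℝ) (e : Edge) : LipschitzWith 1 (tentEdge 𝕜 α s e) := by
  have h := (lipschitzWith_tent s).comp (lipschitzWith_shaftPos (α := α) e)
  rw [one_mul] at h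
  refine LipschitzWith.of_dist_le_mul fun x y => ?_
  rw [dist_eq_norm, tentEdge, tentEdge, ← RCLike.ofReal_sub, RCLike.norm_ofReal]
  exact h.dist_le_mul x y

/-- It ensures that a piece of the shaft meeting the support of a tent does not reach far beyond it.
-/
theorem node_le_two_mul (h0 : 0 ≤ α) (hα1 : α ≤ 1) (n : ℕ) :
    node α n ≤ 2 * node α (n + 1) := by
  have h1 : ((n : ℝ) + 1 + 1) ^ α ≤ 2 * ((n : ℝ) + 1) ^ α := by
    calc ((n : ℝ) + 1 + 1) ^ α ≤ (2 * ((n : ℝ) + 1)) ^ α := by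
          apply Real.rpow_le_rpow (by positivity) _ h0
          linarith [n.cast_nonneg (α := ℝ)]
      _ = 2 ^ α * ((n : ℝ) + 1) ^ α := Real.mul_rpow (by positivity) (by positivity)
      _ ≤ 2 ^ (1 : ℝ) * ((n : ℝ) + 1) ^ α := by
          gcongr
          norm_num
      _ = _ := by rw [Real.rpow_one]
  unfold node
  push_cast
  rw [Real.rpow_neg (by positivity), Real.rpow_neg (by positivity), ← div_eq_mul_inv,
    inv_eq_one_div, div_le_div_iff₀ (by positivity) (by positivity), one_mul]
  exact h1

/-- The function in `H¹` of the comb that depends on the position along the shaft through the tent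
at `s`. -/
theorem exists_isH1Rep_tent (hα : 0 < α) (hα1 : α ≤ 1) {s : ℝ} (hs : 0 < s) :
    ∃ (f : (diagonalComb α hα).Space → 𝕜) (u v : (diagonalComb α hα).L2 𝕜), IsH1Rep f u v ∧
      (∀ e, ∀ x ∈ Icc 0 ((diagonalComb α hα).len e),
        f ((diagonalComb α hα).pt e x) = tentEdge 𝕜 α s e x) ∧
      ‖v‖ ^ 2 ≤ 4 * s := by
  -- From `n₀` on the nodes lie left of the support, so the tent lives on finitely many edges.
  obtain ⟨n₀, hn₀⟩ := eventually_atTop.1 ((tendsto_node hα).eventually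
    (ge_mem_nhds (show 0 < s / 4 by positivity)))
  obtain ⟨f, u, v, hf, hfe, -, -, hv⟩ := exists_isH1Rep_of_lipschitzWith (G := diagonalComb α hα)
    (tentEdge 𝕜 α s) (fun w : Vertex => match w with
      | .joint n => (tent s (node α n) : 𝕜)
      | .tip n => (tent s (node α n) : 𝕜)) (K := 1) (lipschitzWith_tentEdge s)
    (fun e => by
      rcases e with n | n
      · have h1 := node_anti hα n.le_succ
        simp [tentEdge, shaftPos, diagonalComb, vtx, h1]
      · rfl)
    (fun e => by
      rcases e with n | n
      · have h1 := node_anti hα n.le_succ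
        simp [tentEdge, shaftPos, diagonalComb, vtx, len, h1]
      · rfl)
    (s := {e : Edge | ¬ n₀ ≤ e.index}) (tendsto_index.eventually (eventually_ge_atTop n₀))
    (fun e he x => by
      have h1 := hn₀ _ (not_not.1 he)
      rcases e with n | n
      · have h2 : max (node α (n + 1)) (min (node α n) (node α (n + 1) + x)) ≤ s / 4 :=
          max_le ((node_anti hα n.le_succ).trans h1) ((min_le_left _ _).trans h1)
        simp [tentEdge, shaftPos, tent_of_le h2]
      · simp [tentEdge, shaftPos, tent_of_le (show node α n ≤ s / 4 from h1)])
  refine ⟨f, u, v, hf, hfe, ?_⟩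
  have hv0 : ∀ (e : (diagonalComb α hα).Edge) c, tentEdge 𝕜 α s e = (fun _ => c) → v e = 0 :=
    fun e c he => (hv e).trans (toLp_deriv_eq_zero (lipschitzWith_tentEdge s e) he)
  have htooth : ∀ n, v (Edge.tooth n) = 0 := fun n =>
    hv0 (Edge.tooth n) (tent s (node α n) : 𝕜) rfl
  -- The bound telescopes to at most `4 s`. Pieces beyond `7s/4` carry no derivative; a piece
  -- starting before `7s/4` ends before `7s/2 ≤ 4s`, and there the bound is its length, the slope
  -- being at most 1.
  have hshaft : ∀ n, ‖v (Edge.shaft n)‖ ^ 2 ≤ min (node α n) (4 * s) - min (node α (n + 1)) (4 * s) := by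
    intro n
    have hle := node_anti hα n.le_succ
    rcases le_or_gt (7 / 4 * s) (node α (n + 1)) with h1 | h1
    · have h2 := hv0 (Edge.shaft n) 0 (funext fun x => by
        simp only [tentEdge, shaftPos]
        rw [tent_of_ge (h1.trans (le_max_left _ _)), RCLike.ofReal_zero])
      refine (congrArg (fun z => ‖z‖ ^ 2) h2).trans_le ?_
      simpa using sub_nonneg.2 (min_le_min_right (4 * s) hle)
    · have h2 := node_le_two_mul hα.le hα1 n
      rw [min_eq_left (by linarith), min_eq_left (by linarith)]
      exact (congrArg (fun z => ‖z‖ ^ 2) (hv (Edge.shaft n))).trans_le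
        (norm_toLp_deriv_sq_le (len_pos hα (.shaft n)).le (lipschitzWith_tentEdge s (.shaft n)))
  have hsum : HasSum (fun n => ‖v (Edge.shaft n)‖ ^ 2) (‖v‖ ^ 2) := by
    refine (Function.Injective.hasSum_iff (f := fun e : Edge => ‖v e‖ ^ 2) (g := Edge.shaft)
      (fun a b hab => Edge.shaft.inj hab) ?_).2 (hasSum_norm_sq v)
    rintro (n | n) hn
    · exact absurd (mem_range_self n) hn
    · rw [htooth]
      simp
  refine le_of_tendsto' hsum.tendsto_sum_nat fun n => ?_
  refine (Finset.sum_le_sum fun i _ => hshaft i).trans ?_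
  rw [Finset.sum_range_sub' fun i => min (node α i) (4 * s)]
  have h1 : 0 ≤ min (node α n) (4 * s) := le_min (node_pos α n).le (by positivity)
  linarith [min_le_right (node α 0) (4 * s)]

/-- The `m + 1` teeth with index from `m` to `2m` have length between `5s/8` and `s`, because `5/8 ≤
2^(-1/2) ≤ 2^(-α)`. The tent is at least `3s/8` there, so each contributes `(5/8) (3/8)² s³ ≥
s³/16`. The condition `α ≤ 1/2` enters again through `(m + 1) s² ≥ 1`. -/
theorem le_norm_sq_of_tent (hα2 : α ≤ 1 / 2) (m : ℕ) {f : (diagonalComb α hα).Space → 𝕜}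
    {u v : (diagonalComb α hα).L2 𝕜} (hf : IsH1Rep f u v)
    (hfe : ∀ e, ∀ x ∈ Icc 0 ((diagonalComb α hα).len e),
      f ((diagonalComb α hα).pt e x) = tentEdge 𝕜 α (node α m) e x) :
    node α m ≤ 16 * ‖u‖ ^ 2 := by
  set s := node α m
  have hs : 0 < s := node_pos α m
  have h1 : 1 ≤ ((m : ℝ) + 1) * s ^ 2 := by
    have h2 : ((m : ℝ) + 1) * s ^ 2 = ((m : ℝ) + 1) ^ (1 - α * 2) := by
      simp only [s, node]
      rw [← Real.rpow_natCast, ← Real.rpow_mul (by positivity), sub_eq_add_neg,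
        Real.rpow_add (by positivity), Real.rpow_one]
      norm_num
    rw [h2]
    exact Real.one_le_rpow (by linarith [m.cast_nonneg (α := ℝ)]) (by linarith)
  have h2 : 5 / 8 * s ≤ node α (2 * m + 1) := by
    have h3 : node α (2 * m + 1) = 2 ^ (-α) * s := by
      simp only [s, node]
      rw [← Real.mul_rpow (by positivity) (by positivity)]
      congr 1
      push_cast
      ring
    rw [h3]
    gcongr
    calc (5 / 8 : ℝ) ≤ 2 ^ (-(1 / 2) : ℝ) := by
          rw [Real.rpow_neg two_pos.le, ← Real.sqrt_eq_rpow, le_inv_comm₀ (by norm_num) (by positivity)]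
          exact Real.sqrt_le_iff.2 (by norm_num)
      _ ≤ 2 ^ (-α) := by
          gcongr
          norm_num
  have h3 : ∀ n ∈ Finset.Ico m (2 * m + 1), s ^ 3 / 16 ≤ ‖u (Edge.tooth n)‖ ^ 2 := by
    intro n hn
    rw [Finset.mem_Ico] at hn
    have h4 : node α n ≤ s := node_anti hα hn.1
    have h5 : 5 / 8 * s ≤ node α n := h2.trans (node_anti hα hn.2.le)
    have h6 : 3 / 8 * s ≤ tent s (node α n) := le_trans (by linarith) (le_tent_of_le h4)
    have h7 := (hf.isEdgeRep (Edge.tooth n)).le_norm_sq_of_le (node_pos α n) (C := (3 / 8 * s) ^ 2)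
      fun x hx => by
        rw [hfe (Edge.tooth n) x hx]
        simp only [tentEdge, shaftPos, RCLike.norm_ofReal]
        exact pow_le_pow_left₀ (by positivity) (h6.trans (le_abs_self _)) 2
    refine le_trans ?_ h7
    change _ ≤ node α n * (3 / 8 * s) ^ 2
    nlinarith [mul_le_mul_of_nonneg_right h5 (sq_nonneg (3 / 8 * s)), pow_pos hs 3]
  have h4 : ((m : ℝ) + 1) * (s ^ 3 / 16) ≤ ‖u‖ ^ 2 := by
    let i : ℕ ↪ (diagonalComb α hα).Edge := ⟨Edge.tooth, fun a b hab => Edge.tooth.inj hab⟩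
    have h5 := sum_le_hasSum ((Finset.Ico m (2 * m + 1)).map i) (fun e _ => sq_nonneg ‖u e‖)
      (hasSum_norm_sq u)
    rw [Finset.sum_map] at h5
    refine le_trans ?_ ((Finset.sum_le_sum h3).trans h5)
    rw [Finset.sum_const, Nat.card_Ico, nsmul_eq_mul, show 2 * m + 1 - m = m + 1 by omega]
    push_cast
    exact le_rfl
  nlinarith [mul_le_mul_of_nonneg_right h1 hs.le]

/-- Tents centred at nodes that shrink by a factor of at least 7 are orthogonal, and `‖v‖² ≤ 4 s ≤
64 ‖u‖²` bounds them in `H¹` after normalisation in `L²`. -/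
theorem exists_orthonormal_H1 (hα2 : α ≤ 1 / 2) :
    ∃ φ : ℕ → (diagonalComb α hα).H1 𝕜,
      Orthonormal 𝕜 (fun n => formEmbedding ((diagonalComb α hα).H1 𝕜) (φ n)) ∧
      ∃ C : ℝ, ∀ n, ‖φ n‖ ≤ C := by
  obtain ⟨m, -, hm⟩ := exists_seq_of_forall_finset_exists (fun _ : ℕ => True)
    (fun i j => 7 * node α j ≤ node α i) fun t _ => by
      have h1 : ∀ i ∈ t, ∀ᶠ j in atTop, 7 * node α j ≤ node α i := fun i _ => by
        have h2 := (tendsto_node hα).const_mul 7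
        rw [mul_zero] at h2
        exact h2.eventually (ge_mem_nhds (node_pos α i))
      obtain ⟨j, hj⟩ := ((eventually_all_finset t).2 h1).exists
      exact ⟨j, trivial, hj⟩
  choose f u v hf hfe hv using fun k => exists_isH1Rep_tent (𝕜 := 𝕜) hα (by linarith)
    (node_pos α (m k))
  have hu : ∀ k, ‖v k‖ ^ 2 ≤ 64 * ‖u k‖ ^ 2 := fun k => by
    linarith [hv k, le_norm_sq_of_tent hα2 (m k) (hf k) (hfe k)]
  have hu0 : ∀ k, 0 < ‖u k‖ := fun k => by
    have h1 := le_norm_sq_of_tent hα2 (m k) (hf k) (hfe k)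
    have h2 := node_pos α (m k)
    exact norm_pos_iff.2 fun h0 => by rw [h0, norm_zero] at h1; linarith
  have horth : ∀ k l, k < l → inner 𝕜 (u k) (u l) = 0 := fun k l hkl =>
    (hf k).inner_eq_zero (hf l) (forall_of_forall_pt fun e x hx => by
      rw [hfe k e x hx, hfe l e x hx]
      exact (tent_eq_zero_or (hm k l hkl) (shaftPos α e x)).imp
        (fun h => by simp only [tentEdge, h, RCLike.ofReal_zero])
        fun h => by simp only [tentEdge, h, RCLike.ofReal_zero])
  refine ⟨fun k => ⟨((‖u k‖⁻¹ : ℝ) : 𝕜) • WithLp.toLp 2 (u k, v k), Submodule.smul_mem _ _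
    ⟨f k, hf k, fun _ h => h.elim, fun _ h => h.elim⟩⟩, ⟨fun k => ?_, fun k l hkl => ?_⟩, 9,
    fun k => ?_⟩
  · change ‖((‖u k‖⁻¹ : ℝ) : 𝕜) • u k‖ = 1
    rw [norm_smul, RCLike.norm_ofReal, abs_of_pos (inv_pos.2 (hu0 k)), inv_mul_cancel₀ (hu0 k).ne']
  · change inner 𝕜 (((‖u k‖⁻¹ : ℝ) : 𝕜) • u k) (((‖u l‖⁻¹ : ℝ) : 𝕜) • u l) = 0
    rw [inner_smul_left, inner_smul_right]
    rcases hkl.lt_or_gt with h | h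
    · simp [horth k l h]
    · simp [inner_eq_zero_symm.1 (horth l k h)]
  · change ‖((‖u k‖⁻¹ : ℝ) : 𝕜) • WithLp.toLp 2 (u k, v k)‖ ≤ 9
    have hW : ‖WithLp.toLp 2 (u k, v k)‖ ^ 2 = ‖u k‖ ^ 2 + ‖v k‖ ^ 2 :=
      WithLp.prod_norm_sq_eq_of_L2 _
    rw [norm_smul, RCLike.norm_ofReal, abs_of_pos (inv_pos.2 (hu0 k)), inv_mul_le_iff₀ (hu0 k)]
    refine le_of_sq_le_sq ?_ (by linarith [hu0 k])
    -- The squared norm is at most `(1 + 64) ‖u k‖²`, and `65 ≤ 9²`.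
    nlinarith [hu k, sq_nonneg ‖u k‖]

end DiagonalComb

end

/-! ### The theorem. -/

theorem mainTheorem2 (𝕜 : Type*) [RCLike 𝕜] (α : ℝ) (hα : 0 < α) :
    IsSelfAdjoint ((diagonalComb α hα).neumannLaplacian 𝕜) ∧
    IsSelfAdjoint (DiagonalComb.dirichletLaplacian 𝕜 α hα) ∧
    (1 / 2 < α →
      IsCompactOperator (formEmbedding ((diagonalComb α hα).H1 𝕜)) ∧
      ((diagonalComb α hα).neumannLaplacian 𝕜).HasCompactResolvent ∧
      ((diagonalComb α hα).neumannLaplacian 𝕜).HasPurelyDiscreteSpectrum) ∧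
    (α ≤ 1 / 2 →
      (∃ φ : ℕ → (diagonalComb α hα).H1 𝕜,
        Orthonormal 𝕜 (fun n => formEmbedding ((diagonalComb α hα).H1 𝕜) (φ n)) ∧
        ∃ C : ℝ, ∀ n, ‖φ n‖ ≤ C) ∧
      ((diagonalComb α hα).neumannLaplacian 𝕜).essentialSpectrum.Nonempty) ∧
    (IsCompactOperator (formEmbedding (DiagonalComb.H1Dirichlet 𝕜 α hα)) ∧
      (DiagonalComb.dirichletLaplacian 𝕜 α hα).HasCompactResolvent ∧
      (DiagonalComb.dirichletLaplacian 𝕜 α hα).HasPurelyDiscreteSpectrum) := by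
  have hN : IsSymmetricInverseAddOne ((diagonalComb α hα).neumannLaplacian 𝕜)
      (formResolvent ((diagonalComb α hα).H1Dirichlet 𝕜 ∅ ∅)) :=
    DiagonalComb.isSymmetricInverseAddOne_mixed ∅ (empty_subset _)
  have hD : IsSymmetricInverseAddOne (DiagonalComb.dirichletLaplacian 𝕜 α hα)
      (formResolvent ((diagonalComb α hα).H1Dirichlet 𝕜 (DiagonalComb.tips α hα)
        {DiagonalComb.endZero α hα})) :=
    DiagonalComb.isSymmetricInverseAddOne_mixed _ Subset.rfl
  refine ⟨hN.isSelfAdjoint, hD.isSelfAdjoint, fun h => ?_, fun h => ?_, ?_⟩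
  · have hK := DiagonalComb.isCompactOperator_H1 (𝕜 := 𝕜) (hα := hα) h
    have hR := isCompactOperator_formResolvent ((diagonalComb α hα).H1Dirichlet 𝕜 ∅ ∅) hK
    exact ⟨hK, hN.hasCompactResolvent hR, hN.hasPurelyDiscreteSpectrum hR⟩
  · obtain ⟨φ, hφ, C, hC⟩ := DiagonalComb.exists_orthonormal_H1 (𝕜 := 𝕜) (hα := hα) h
    have hC0 : 0 < max C 1 := lt_max_of_lt_right one_pos
    exact ⟨⟨φ, hφ, C, hC⟩, hN.essentialSpectrum_nonempty hφ (inv_pos.2 (pow_pos hC0 2))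
      fun n => le_inner_formResolvent ((diagonalComb α hα).H1Dirichlet 𝕜 ∅ ∅) (φ n) hC0 ((hC n).trans (le_max_left _ _)) (hφ.1 n)⟩
  · have hK := DiagonalComb.isCompactOperator_H1Dirichlet (𝕜 := 𝕜) (hα := hα)
    have hR := isCompactOperator_formResolvent ((diagonalComb α hα).H1Dirichlet 𝕜 (DiagonalComb.tips α hα)
      {DiagonalComb.endZero α hα}) hK
    exact ⟨hK, hD.hasCompactResolvent hR, hD.hasPurelyDiscreteSpectrum hR⟩
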